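/- Let $\tau\in i\mathbb{R}$, $\tau\neq 0$, let $\mathbb{T}=\mathbb{C}/(\mathbb{Z}+\mathbb{Z}\tau)$, and let $\gamma=[\tfrac{\tau}{2},1+\tfrac{\tau}{2}]$. Let $w$ be a positive integrable weight function on $\gamma$. Let $\{\pi_n\}_{n\ge 0,\,n\neq 1}$ be the orthonormal elliptic orthogonal polynomials (EOPs) for $w$: each $\pi_n$ is a doubly periodic meromorphic function on $\mathbb{T}$ that is holomorphic away from $z=0$ and has order exactly $-n$ at $z=0$ (a pole of order $n$ if $n\ge 2$; a nonzero constant if $n=0$), with leading behaviour $\pi_n(z)=\kappa_n z^{-n}(1+\mathcal{O}(z))$ as $z\to 0$ for some $\kappa_n>0$, and $$\int_\gamma \pi_n(z)\,\pi_m(z)\,w(z)\,dz=\delta_{n,m},\qquad n,m\in\{0,2,3,\dots\}.$$ Then for every $n\in\{0,2,3,\dots\}$ all zeros of $\pi_n$ are simple. -/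

import Mathlib

open Filter Topology Asymptotics

/-- The lattice `ℤ + ℤ τ` in `ℂ`. -/
def torusLattice (τ : ℂ) : Submodule ℤ ℂ := Submodule.span ℤ {1, τ}

/-- `f` represents a meromorphic function on the torus `ℂ / (ℤ + ℤ τ)` whose only possible pole is
at the origin, and whose pole there has order exactly `n` (for `n = 0`: a finite nonzero limit).
The value of `f` at the lattice points themselves plays no role. -/
structure IsEllipticPolynomial (τ : ℂ) (n : ℕ) (f : ℂ → ℂ) : Prop where
  periodic_one : Function.Periodic f 1
  periodic_tau : Function.Periodic f τ
  meromorphic : Meromorphic f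
  analyticAt : ∀ z, z ∉ torusLattice τ → AnalyticAt ℂ f z
  order_zero : meromorphicOrderAt f 0 = ((-(n : ℤ) : ℤ) : WithTop ℤ)

/-- A positive weight on the cycle `γ = [τ/2, 1 + τ/2]`, integrable along `γ`
(equivalently, every product of two elliptic polynomials is integrable against it). -/
structure IsCycleWeight (τ : ℂ) (w : ℂ → ℝ) : Prop where
  pos : ∀ x ∈ Set.Icc (0 : ℝ) 1, 0 < w (τ / 2 + x)
  integrable : IntervalIntegrable (fun x : ℝ => w (τ / 2 + x)) MeasureTheory.volume 0 1

/-- The pairing `∫_γ f(z) g(z) w(z) dz`, with `γ` parametrized by `z = τ/2 + x`, `x ∈ [0,1]`. -/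
noncomputable def cyclePairing (τ : ℂ) (w : ℂ → ℝ) (f g : ℂ → ℂ) : ℂ :=
  ∫ x in (0 : ℝ)..1, f (τ / 2 + x) * g (τ / 2 + x) * (w (τ / 2 + x) : ℂ)

/-- The family `(π n)`, `n ∈ {0, 2, 3, …}`, of orthonormal elliptic orthogonal polynomials for the
weight `w` on `γ`: `π n` is an elliptic polynomial of degree `n` which is a positive multiple of a
monic one, `π n z = κ z⁻ⁿ (1 + O(z))` with `κ > 0`, and the family is orthonormal.
Nothing is asked of the entry `π 1`, since the index `1` does not occur. -/
structure IsOrthonormalEOPFamily (τ : ℂ) (w : ℂ → ℝ) (π : ℕ → ℂ → ℂ) : Prop where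
  elliptic : ∀ n, n ≠ 1 → IsEllipticPolynomial τ n (π n)
  leading : ∀ n, n ≠ 1 → ∃ κ : ℝ, 0 < κ ∧
    (fun z : ℂ => z ^ n * π n z - (κ : ℂ)) =O[𝓝[≠] 0] (fun z : ℂ => z)
  orthonormal : ∀ n m, n ≠ 1 → m ≠ 1 →
    cyclePairing τ w (π n) (π m) = if n = m then 1 else 0

/-- `z` is a zero of the meromorphic function `f`. -/
def IsZeroOf (f : ℂ → ℂ) (z : ℂ) : Prop := 0 < meromorphicOrderAt f z

/-- `z` is a simple zero of the meromorphic function `f`, i.e. a zero of multiplicity one. -/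
def IsSimpleZeroOf (f : ℂ → ℂ) (z : ℂ) : Prop := meromorphicOrderAt f z = 1

/-! A zero of `π n` of order at least two would leave it with more zeros than its pole of order `n`
allows. A nonzero elliptic function whose only pole is at the origin, of order at most `N`, has at
most `N` zeros on the torus, counted with multiplicity (`sum_meromorphicOrderAt_le`). On the other
hand `π n` is real on `γ` and has at least `n - 1` zeros of odd order there
(`IsOrthonormalEOPFamily.le_card_odd_order`). A multiple zero at one of these has order at least
three, and one elsewhere has order at least two; either way the total reaches `n + 1`.

Reality holds because conjugation maps `γ` to itself modulo `τ`: the reflection of `π n` has the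
same leading coefficient, so the difference is a combination of lower `π m`, and orthogonality kills
it.

For the sign changes, let `k` be the number of odd-order zeros of `π n` on `γ` and suppose `k ≤ n -
2`. Periodicity makes `k` even (`even_card_of_odd_order`). The `k + 1` functions `π 0, π 2, …, π (k
+ 1)` have a nontrivial real combination `p` vanishing at these zeros. Its degree allows `k + 1`
zeros, which is one too many, as degree one is missing; but its odd-order zeros on `γ` are also even
in number, and parity removes the spare one. So `p` has simple zeros exactly where `π n` changes
sign and no others on `γ`. Then `p * π n` has constant sign there and its integral is nonzero,
against orthogonality to lower degrees. -/

/-! ### Residue theorem on a period rectangle. -/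

section Rectangle

open Complex Set
open scoped Interval

/-- The boundary integral of `f` over the rectangle with opposite corners `z` and `w`. -/
noncomputable def rectIntegral (f : ℂ → ℂ) (z w : ℂ) : ℂ :=
  (∫ x : ℝ in z.re..w.re, f (x + z.im * I)) - (∫ x : ℝ in z.re..w.re, f (x + w.im * I)) +
    I • (∫ y : ℝ in z.im..w.im, f (w.re + y * I)) -
    I • ∫ y : ℝ in z.im..w.im, f (z.re + y * I)

/-- The boundary of the rectangle with opposite corners `z` and `w`. -/
def rectBoundary (z w : ℂ) : Set ℂ :=
  {u | u ∈ [[z.re, w.re]] ×ℂ [[z.im, w.im]] ∧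
    (u.im = z.im ∨ u.im = w.im ∨ u.re = w.re ∨ u.re = z.re)}

theorem intervalIntegrable_edges {f : ℂ → ℂ} {z w : ℂ} (hf : ContinuousOn f (rectBoundary z w)) :
    IntervalIntegrable (fun x : ℝ => f (x + z.im * I)) MeasureTheory.volume z.re w.re ∧
    IntervalIntegrable (fun x : ℝ => f (x + w.im * I)) MeasureTheory.volume z.re w.re ∧
    IntervalIntegrable (fun y : ℝ => f (w.re + y * I)) MeasureTheory.volume z.im w.im ∧
    IntervalIntegrable (fun y : ℝ => f (z.re + y * I)) MeasureTheory.volume z.im w.im := by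
  refine ⟨?_, ?_, ?_, ?_⟩ <;> refine (hf.comp (by fun_prop) ?_).intervalIntegrable <;> intro x hx <;>
    simp [rectBoundary, mem_reProdIm, hx]

theorem rectIntegral_congr {f g : ℂ → ℂ} {z w : ℂ} (h : EqOn f g (rectBoundary z w)) :
    rectIntegral f z w = rectIntegral g z w := by
  have hB : ∀ x ∈ [[z.re, w.re]], f (x + z.im * I) = g (x + z.im * I) := fun x hx =>
    h (by simp [rectBoundary, mem_reProdIm, hx])
  have hT : ∀ x ∈ [[z.re, w.re]], f (x + w.im * I) = g (x + w.im * I) := fun x hx =>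
    h (by simp [rectBoundary, mem_reProdIm, hx])
  have hR : ∀ y ∈ [[z.im, w.im]], f (w.re + y * I) = g (w.re + y * I) := fun y hy =>
    h (by simp [rectBoundary, mem_reProdIm, hy])
  have hL : ∀ y ∈ [[z.im, w.im]], f (z.re + y * I) = g (z.re + y * I) := fun y hy =>
    h (by simp [rectBoundary, mem_reProdIm, hy])
  unfold rectIntegral
  rw [intervalIntegral.integral_congr hB, intervalIntegral.integral_congr hT,
    intervalIntegral.integral_congr hR, intervalIntegral.integral_congr hL]

theorem rectIntegral_add {f g : ℂ → ℂ} {z w : ℂ} (hf : ContinuousOn f (rectBoundary z w))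
    (hg : ContinuousOn g (rectBoundary z w)) :
    rectIntegral (fun u => f u + g u) z w = rectIntegral f z w + rectIntegral g z w := by
  obtain ⟨f1, f2, f3, f4⟩ := intervalIntegrable_edges hf
  obtain ⟨g1, g2, g3, g4⟩ := intervalIntegrable_edges hg
  unfold rectIntegral
  rw [intervalIntegral.integral_add f1 g1, intervalIntegral.integral_add f2 g2,
    intervalIntegral.integral_add f3 g3, intervalIntegral.integral_add f4 g4]
  simp only [smul_eq_mul]
  ring

theorem rectIntegral_const_mul (c : ℂ) (f : ℂ → ℂ) (z w : ℂ) :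
    rectIntegral (fun u => c * f u) z w = c * rectIntegral f z w := by
  unfold rectIntegral
  simp only [intervalIntegral.integral_const_mul, smul_eq_mul]
  ring

theorem rectIntegral_sum {ι : Type*} (s : Finset ι) {f : ι → ℂ → ℂ} {z w : ℂ}
    (hf : ∀ i ∈ s, ContinuousOn (f i) (rectBoundary z w)) :
    rectIntegral (fun u => ∑ i ∈ s, f i u) z w = ∑ i ∈ s, rectIntegral (f i) z w := by
  classical
  induction s using Finset.induction_on with
  | empty => simp [rectIntegral]
  | insert a s ha ih =>
    simp only [Finset.sum_insert ha]
    rw [rectIntegral_add (hf a (by simp))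
      (continuousOn_finsetSum s fun i hi => hf i (by simp [hi])), ih fun i hi => hf i (by simp [hi])]

/-- Along a line inside the slit plane the principal logarithm is a primitive. This serves for each
edge of a rectangle, after a change of sign for the left one. -/
theorem mul_integral_inv_eq_log_sub_log {p q : ℂ} (h : ∀ x : ℝ, p * x + q ∈ slitPlane) (a b : ℝ) :
    p * ∫ x : ℝ in a..b, (p * x + q)⁻¹ = log (p * b + q) - log (p * a + q) := by
  rw [← intervalIntegral.integral_const_mul]
  refine intervalIntegral.integral_eq_sub_of_hasDerivAt (f := fun x : ℝ => log (p * x + q))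
    (fun x _ => ?_) ?_
  · have h1 : HasDerivAt (fun x : ℝ => p * x + q) p x := by
      simpa using (((hasDerivAt_id x).ofReal_comp).const_mul p).add_const q
    simpa [div_eq_mul_inv] using h1.clog_real (h x)
  · refine Continuous.intervalIntegrable (continuous_const.mul
      (Continuous.inv₀ (by fun_prop) fun x => slitPlane_ne_zero (h x))) _ _

/-- The winding number of the boundary of a rectangle around an interior point is one. -/
theorem rectIntegral_sub_inv {z w a : ℂ} (h1 : z.re < a.re) (h2 : a.re < w.re) (h3 : z.im < a.im)
    (h4 : a.im < w.im) : rectIntegral (fun u => (u - a)⁻¹) z w = 2 * Real.pi * I := by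
  have hB := mul_integral_inv_eq_log_sub_log (p := 1) (q := z.im * I - a)
    (fun x => by simp [mem_slitPlane_iff, sub_ne_zero, h3.ne]) z.re w.re
  have hT := mul_integral_inv_eq_log_sub_log (p := 1) (q := w.im * I - a)
    (fun x => by simp [mem_slitPlane_iff, sub_ne_zero, h4.ne']) z.re w.re
  have hR := mul_integral_inv_eq_log_sub_log (p := I) (q := w.re - a)
    (fun x => by simp [mem_slitPlane_iff, h2]) z.im w.im
  have hL := mul_integral_inv_eq_log_sub_log (p := -I) (q := -(z.re - a))
    (fun x => by simp [mem_slitPlane_iff, h1]) z.im w.im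
  have eB : ∀ x : ℝ, (x + z.im * I - a : ℂ) = 1 * x + (z.im * I - a) := fun x => by ring
  have eT : ∀ x : ℝ, (x + w.im * I - a : ℂ) = 1 * x + (w.im * I - a) := fun x => by ring
  have eR : ∀ y : ℝ, (w.re + y * I - a : ℂ) = I * y + (w.re - a) := fun x => by ring
  have eL : ∀ y : ℝ, (z.re + y * I - a : ℂ) = -(-I * y + -(z.re - a)) := fun x => by ring
  -- Seen from `a`, the left edge crosses the branch cut, so its logarithm is taken of the negative.
  -- Returning to the common branch costs `π * I` at each of the two left corners, which is the
  -- whole winding number.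
  have e1 : log (-(z.re + w.im * I - a)) = log (z.re + w.im * I - a) - Real.pi * I := by
    rw [log, arg_neg_eq_arg_sub_pi_of_im_pos (by simp [h4]), norm_neg, log]
    push_cast
    ring
  have e2 : log (-(z.re + z.im * I - a)) = log (z.re + z.im * I - a) + Real.pi * I := by
    rw [log, arg_neg_eq_arg_add_pi_of_im_neg (by simp [h3]), norm_neg, log]
    push_cast
    ring
  have cBL : -I * z.im + -(z.re - a) = -(z.re + z.im * I - a) := by ring
  have cTL : -I * w.im + -(z.re - a) = -(z.re + w.im * I - a) := by ring
  rw [cBL, cTL, e1, e2] at hL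
  simp only [rectIntegral, smul_eq_mul]
  simp only [eB, eT, eR, eL, inv_neg, intervalIntegral.integral_neg] at hL ⊢
  rw [one_mul] at hB hT
  rw [hB, hT, hR]
  have cTR : log (I * w.im + (w.re - a)) = log (1 * w.re + (w.im * I - a)) := by congr 1; ring
  have cBR : log (I * z.im + (w.re - a)) = log (1 * w.re + (z.im * I - a)) := by congr 1; ring
  rw [cTR, cBR]
  linear_combination -hL

theorem rectIntegral_eq_zero_of_analyticAt {f : ℂ → ℂ} {z w : ℂ}
    (hf : ∀ u ∈ [[z.re, w.re]] ×ℂ [[z.im, w.im]], AnalyticAt ℂ f u) : rectIntegral f z w = 0 :=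
  integral_boundary_rect_eq_zero_of_differentiableOn f z w
    fun u hu => (hf u hu).differentiableAt.differentiableWithinAt

/-- Opposite edges carry the same values with opposite orientations. -/
theorem rectIntegral_eq_zero_of_periodic {f : ℂ → ℂ} {z w : ℂ}
    (h1 : Function.Periodic f (w.re - z.re : ℝ)) (h2 : Function.Periodic f ((w.im - z.im : ℝ) * I)) :
    rectIntegral f z w = 0 := by
  have e1 : ∀ x : ℝ, f (x + w.im * I) = f (x + z.im * I) := fun x => by
    rw [← h2 (x + z.im * I)]; congr 1; push_cast; ring
  have e2 : ∀ y : ℝ, f (w.re + y * I) = f (z.re + y * I) := fun x => by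
    rw [← h1 (z.re + x * I)]; congr 1; push_cast; ring
  simp [rectIntegral, e1, e2]

/-- The residues of a doubly periodic function with simple poles in a period rectangle add up
to zero. -/
theorem sum_residues_eq_zero {g : ℂ → ℂ} {z w : ℂ} (hg : Meromorphic g)
    (h1 : Function.Periodic g (w.re - z.re : ℝ)) (h2 : Function.Periodic g ((w.im - z.im : ℝ) * I))
    (hcont : ∀ u ∈ rectBoundary z w, ContinuousAt g u) (S : Finset ℂ)
    (hS : ∀ a ∈ S, (z.re < a.re ∧ a.re < w.re) ∧ z.im < a.im ∧ a.im < w.im) (c : ℂ → ℂ)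
    (hord : ∀ u ∈ [[z.re, w.re]] ×ℂ [[z.im, w.im]],
      0 ≤ meromorphicOrderAt (fun v => g v - ∑ a ∈ S, c a * (v - a)⁻¹) u) :
    ∑ a ∈ S, c a = 0 := by
  set p : ℂ → ℂ := fun v => ∑ a ∈ S, c a * (v - a)⁻¹ with hp
  have hpm : Meromorphic p := fun u => by
    refine MeromorphicAt.fun_sum fun a _ => ?_
    fun_prop
  have hne : ∀ a ∈ S, ∀ u ∈ rectBoundary z w, u - a ≠ 0 := by
    rintro a ha u ⟨-, hu⟩ h0
    obtain rfl := sub_eq_zero.1 h0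
    obtain ⟨⟨a1, a2⟩, a3, a4⟩ := hS u ha
    rcases hu with h | h | h | h <;> linarith
  have hpc : ∀ a ∈ S, ∀ u ∈ rectBoundary z w, ContinuousAt (fun v => c a * (v - a)⁻¹) u :=
    fun a ha u hu => continuousAt_const.mul (ContinuousAt.inv₀ (by fun_prop) (hne a ha u hu))
  have hpcont : ∀ u ∈ rectBoundary z w, ContinuousAt p u := fun u hu =>
    tendsto_finsetSum S fun a ha => hpc a ha u hu
  have hm : MeromorphicOn (fun v => g v - p v) univ := fun u _ => (hg u).sub (hpm u)
  -- Only the order of `g - p` is controlled, so its values at removable singularities may be wrong;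
  -- the normal form corrects them. On the boundary `g` is continuous and nothing changes.
  set h := toMeromorphicNFOn (fun v => g v - p v) univ with hh
  have hhan : ∀ u ∈ [[z.re, w.re]] ×ℂ [[z.im, w.im]], AnalyticAt ℂ h u := fun u hu => by
    have hnf := meromorphicNFOn_toMeromorphicNFOn (fun v => g v - p v) univ (mem_univ u)
    rw [← hnf.meromorphicOrderAt_nonneg_iff_analyticAt,
      meromorphicOrderAt_toMeromorphicNFOn hm (mem_univ u)]
    exact hord u hu
  have heq : EqOn g (fun u => h u + p u) (rectBoundary z w) := fun u hu => by
    have hc1 : ContinuousAt (fun v => g v - p v) u := (hcont u hu).sub (hpcont u hu)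
    have := (hc1.eventuallyEq_nhds_iff_eventuallyEq_nhdsNE (hhan u hu.1).continuousAt).1
      (hm.toMeromorphicNFOn_eq_self_on_nhdsNE (mem_univ u)).symm
    have := this.eq_of_nhds
    simp only [← this]
    ring
  have hsum : rectIntegral g z w = ∑ a ∈ S, c a * (2 * Real.pi * I) := by
    rw [rectIntegral_congr heq, rectIntegral_add
      (fun u hu => (hhan u hu.1).continuousAt.continuousWithinAt)
      (fun u hu => (hpcont u hu).continuousWithinAt), rectIntegral_eq_zero_of_analyticAt hhan,
      zero_add, hp, rectIntegral_sum S fun a ha u hu => (hpc a ha u hu).continuousWithinAt]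
    refine Finset.sum_congr rfl fun a ha => ?_
    obtain ⟨⟨a1, a2⟩, a3, a4⟩ := hS a ha
    rw [rectIntegral_const_mul, rectIntegral_sub_inv a1 a2 a3 a4]
  rw [rectIntegral_eq_zero_of_periodic h1 h2, ← Finset.sum_mul] at hsum
  exact (mul_eq_zero.1 hsum.symm).resolve_right two_pi_I_ne_zero

end Rectangle

/-! ### The lattice and periodic functions. -/

section Lattice

theorem mem_torusLattice {τ z : ℂ} : z ∈ torusLattice τ ↔ ∃ m n : ℤ, (m : ℂ) + n * τ = z := by
  simp [torusLattice, Submodule.mem_span_pair]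

theorem torusLattice_neg (τ : ℂ) : torusLattice (-τ) = torusLattice τ := by
  ext z
  simp only [mem_torusLattice]
  constructor <;> rintro ⟨m, n, rfl⟩ <;> exact ⟨m, -n, by push_cast; ring⟩

theorem countable_torusLattice (τ : ℂ) : (torusLattice τ : Set ℂ).Countable := by
  refine (Set.countable_range fun p : ℤ × ℤ => (p.1 : ℂ) + p.2 * τ).mono fun z hz => ?_
  obtain ⟨m, n, h⟩ := mem_torusLattice.1 hz
  exact ⟨(m, n), h⟩

theorem periodic_of_mem_torusLattice {τ ω : ℂ} {f : ℂ → ℂ} (h1 : Function.Periodic f 1)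
    (h2 : Function.Periodic f τ) (hω : ω ∈ torusLattice τ) : Function.Periodic f ω := by
  obtain ⟨m, n, rfl⟩ := mem_torusLattice.1 hω
  have := (h1.int_mul m).add_period (h2.int_mul n)
  simpa using this

theorem Function.Periodic.meromorphicOrderAt_add {f : ℂ → ℂ} {c : ℂ} (h : Function.Periodic f c)
    (z : ℂ) : meromorphicOrderAt f (z + c) = meromorphicOrderAt f z := by
  rw [← meromorphicOrderAt_comp_add_const_eq_meromorphicOrderAt]
  congr 1
  exact funext h

theorem Function.Periodic.logDeriv {f : ℂ → ℂ} {c : ℂ} (h : Function.Periodic f c) :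
    Function.Periodic (logDeriv f) c := fun z => by
  have : f = fun x => f (x + c) := (funext h).symm
  rw [logDeriv_apply, logDeriv_apply, h z, ← deriv_comp_add_const, ← this]

end Lattice

/-! ### Logarithmic derivatives and the spaces of elliptic functions. -/

/-- Subtracting `ord_u f / (v - u)` from the logarithmic derivative of `f` removes its singularity
at `u`. -/
theorem meromorphicOrderAt_logDeriv_sub_nonneg {f : ℂ → ℂ} {u : ℂ} (hf : MeromorphicAt f u)
    (h : meromorphicOrderAt f u ≠ ⊤) :
    0 ≤ meromorphicOrderAt
      (fun v => logDeriv f v - ((meromorphicOrderAt f u).untop₀ : ℂ) * (v - u)⁻¹) u := by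
  lift meromorphicOrderAt f u to ℤ using h with n hn
  obtain ⟨g, hg, hg0, hfg⟩ := (meromorphicOrderAt_eq_int_iff hf).1 hn.symm
  have hlg : AnalyticAt ℂ (logDeriv g) u := hg.deriv.div hg hg0
  rw [meromorphicOrderAt_congr (f₂ := logDeriv g)]
  · exact hlg.meromorphicOrderAt_nonneg
  have hfg' : f =ᶠ[𝓝[≠] u] fun z => (z - u) ^ n * g z := hfg
  filter_upwards [logDeriv_congr_nhdsNE hfg', self_mem_nhdsWithin,
    (hg.eventually_analyticAt.and (hg.continuousAt.eventually_ne hg0)).filter_mono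
      nhdsWithin_le_nhds] with v hv hvu hgv
  have hvu : v - u ≠ 0 := sub_ne_zero.2 hvu
  have hd : DifferentiableAt ℂ (fun z => (z - u) ^ n) v :=
    DifferentiableAt.zpow (by fun_prop) (Or.inl hvu)
  rw [hv, logDeriv_mul (f := fun z => (z - u) ^ n) v (zpow_ne_zero _ hvu) hgv.2 hd hgv.1.differentiableAt,
    logDeriv_fun_zpow (by fun_prop), logDeriv_apply (fun z => z - u)]
  simp [div_eq_mul_inv]

/-- Countability lets the edges of a period rectangle be placed away from all zeros and poles. -/
theorem Meromorphic.countable_meromorphicOrderAt_ne_zero {f : ℂ → ℂ} (hf : Meromorphic f)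
    (h : ∀ z, meromorphicOrderAt f z ≠ ⊤) : {z | meromorphicOrderAt f z ≠ 0}.Countable := by
  have hd := (meromorphicOn_univ.2 hf).codiscreteWithin_setOfPred_meromorphicOrderAt_eq_zero_or_top
  have : {z | meromorphicOrderAt f z ≠ 0} =
      {z | z ∈ Set.univ ∧ (meromorphicOrderAt f z = 0 ∨ meromorphicOrderAt f z = ⊤)}ᶜ := by
    ext z; simp [h z]
  rw [this, ← Set.inter_univ (_ᶜ)]
  exact (HereditarilyLindelofSpace.isLindelof _).countable_of_isDiscrete
    (isDiscrete_of_codiscreteWithin (by simpa using! hd fun z _ => h z))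

/-- The space of functions on the torus `ℂ / (ℤ + ℤ τ)` that are holomorphic away from the origin
and have a pole of order at most `N` there. -/
def ellipticSpace (τ : ℂ) (N : ℕ) : Submodule ℂ (ℂ → ℂ) where
  carrier := {f | Function.Periodic f 1 ∧ Function.Periodic f τ ∧ Meromorphic f ∧
    (∀ z, z ∉ torusLattice τ → AnalyticAt ℂ f z) ∧
    ((-(N : ℤ) : ℤ) : WithTop ℤ) ≤ meromorphicOrderAt f 0}
  zero_mem' := by
    refine ⟨fun _ => rfl, fun _ => rfl, Meromorphic.const 0, fun _ _ => analyticAt_const, ?_⟩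
    exact le_top.trans_eq
      (meromorphicOrderAt_eq_top_iff.2 (Eventually.of_forall fun _ => rfl)).symm
  add_mem' := by
    rintro f g ⟨f1, f2, f3, f4, f5⟩ ⟨g1, g2, g3, g4, g5⟩
    exact ⟨f1.add g1, f2.add g2, f3.add g3, fun z hz => (f4 z hz).add (g4 z hz),
      (le_min f5 g5).trans (meromorphicOrderAt_add (f3 0) (g3 0))⟩
  smul_mem' := by
    rintro c f ⟨f1, f2, f3, f4, f5⟩
    refine ⟨f1.smul c, f2.smul c, f3.const_smul c, fun z hz => (f4 z hz).const_smul, ?_⟩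
    by_cases hc : c = 0
    · rw [meromorphicOrderAt_eq_top_iff.2 (Eventually.of_forall fun _ => by simp [hc])]
      exact le_top
    · exact f5.trans_eq (meromorphicOrderAt_smul_of_ne_zero (g := fun _ => c) analyticAt_const hc).symm

theorem ellipticSpace_mono (τ : ℂ) {M N : ℕ} (h : M ≤ N) :
    ellipticSpace τ M ≤ ellipticSpace τ N := by
  rintro f ⟨f1, f2, f3, f4, f5⟩
  exact ⟨f1, f2, f3, f4, le_trans (by exact_mod_cast neg_le_neg (Int.ofNat_le.2 h)) f5⟩

theorem ellipticSpace_neg (τ : ℂ) (N : ℕ) : ellipticSpace (-τ) N = ellipticSpace τ N := by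
  ext f
  constructor
  · rintro ⟨f1, f2, f3, f4, f5⟩
    exact ⟨f1, by simpa using f2.neg, f3, by simpa [torusLattice_neg] using f4, f5⟩
  · rintro ⟨f1, f2, f3, f4, f5⟩
    exact ⟨f1, f2.neg, f3, by simpa [torusLattice_neg] using f4, f5⟩

theorem IsEllipticPolynomial.mem_ellipticSpace {τ : ℂ} {n : ℕ} {f : ℂ → ℂ}
    (h : IsEllipticPolynomial τ n f) : f ∈ ellipticSpace τ n :=
  ⟨h.periodic_one, h.periodic_tau, h.meromorphic, h.analyticAt, h.order_zero.ge⟩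

/-! ### Counting zeros and poles on the torus. -/

section Valence

open Complex Set

/-- Reduction of a complex number modulo `1` and `t * I` into the half-open rectangle with lower
left corner `z₀`. -/
noncomputable def rectMod (z₀ : ℂ) {t : ℝ} (ht : 0 < t) (z : ℂ) : ℂ :=
  ⟨toIcoMod one_pos z₀.re z.re, toIcoMod ht z₀.im z.im⟩

theorem rectMod_mem (z₀ : ℂ) {t : ℝ} (ht : 0 < t) (z : ℂ) :
    rectMod z₀ ht z ∈ Ico z₀.re (z₀.re + 1) ×ℂ Ico z₀.im (z₀.im + t) :=
  ⟨toIcoMod_mem_Ico _ _ _, toIcoMod_mem_Ico _ _ _⟩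

theorem rectMod_eq_self {z₀ z : ℂ} {t : ℝ} (ht : 0 < t)
    (hz : z ∈ Ico z₀.re (z₀.re + 1) ×ℂ Ico z₀.im (z₀.im + t)) : rectMod z₀ ht z = z :=
  Complex.ext ((toIcoMod_eq_self _).2 hz.1) ((toIcoMod_eq_self _).2 hz.2)

theorem sub_rectMod_mem (z₀ : ℂ) {t : ℝ} (ht : 0 < t) (z : ℂ) :
    z - rectMod z₀ ht z ∈ torusLattice (t * I) := by
  refine mem_torusLattice.2 ⟨toIcoDiv one_pos z₀.re z.re, toIcoDiv ht z₀.im z.im, ?_⟩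
  have h1 := toIcoMod_add_toIcoDiv_zsmul (one_pos (α := ℝ)) z₀.re z.re
  have h2 := toIcoMod_add_toIcoDiv_zsmul ht z₀.im z.im
  apply Complex.ext
  · simp [rectMod] at h1 ⊢
  · simp [rectMod] at h2 ⊢

theorem rectMod_eq_of_sub_mem {z₀ z z' : ℂ} {t : ℝ} (ht : 0 < t)
    (h : z' - z ∈ torusLattice (t * I)) : rectMod z₀ ht z = rectMod z₀ ht z' := by
  obtain ⟨m, n, h⟩ := mem_torusLattice.1 h
  have hre := congrArg re h
  have him := congrArg im h
  simp at hre him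
  refine Complex.ext ((toIcoMod_inj _).2 ?_) ((toIcoMod_inj _).2 ?_)
  · refine AddCommGroup.modEq_iff_zsmul.2 ⟨m, ?_⟩
    simp; linarith
  · refine AddCommGroup.modEq_iff_zsmul.2 ⟨n, ?_⟩
    simp; linarith

theorem meromorphicOrderAt_ne_top_of_mem_ellipticSpace {τ : ℂ} {N : ℕ} {f : ℂ → ℂ}
    (hf : f ∈ ellipticSpace τ N) {u : ℂ} (hu : meromorphicOrderAt f u ≠ ⊤) (z : ℂ) :
    meromorphicOrderAt f z ≠ ⊤ :=
  hf.2.2.1.exists_meromorphicOrderAt_ne_top_iff_forall.1 ⟨u, hu⟩ z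

/-- The argument principle: the orders of `f` over a period rectangle sum to zero, the origin
contributes at least `-N`, and all other orders are nonnegative. The point `u₀` only says that `f`
does not vanish identically. -/
theorem sum_meromorphicOrderAt_le_of_pos {t : ℝ} (ht : 0 < t) {N : ℕ} {f : ℂ → ℂ}
    (hf : f ∈ ellipticSpace (t * I) N) {u₀ : ℂ} (hu₀ : meromorphicOrderAt f u₀ ≠ ⊤) (T : Finset ℂ)
    (hT : ∀ a ∈ T, a ∉ torusLattice (t * I))
    (hTinj : ∀ a ∈ T, ∀ b ∈ T, a - b ∈ torusLattice (t * I) → a = b) :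
    ∑ a ∈ T, (meromorphicOrderAt f a).untop₀ ≤ N := by
  classical
  have htop := meromorphicOrderAt_ne_top_of_mem_ellipticSpace hf hu₀
  obtain ⟨per1, perτ, hmer, han, h0⟩ := hf
  have hperL : ∀ ω ∈ torusLattice (t * I), ∀ z,
      meromorphicOrderAt f (z + ω) = meromorphicOrderAt f z := fun ω hω z =>
    (periodic_of_mem_torusLattice per1 perτ hω).meromorphicOrderAt_add z
  set Z : Set ℂ := {z | meromorphicOrderAt f z ≠ 0} ∪ torusLattice (t * I) with hZ
  have hZc : Z.Countable :=
    (hmer.countable_meromorphicOrderAt_ne_zero htop).union (countable_torusLattice _)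
  have hZper : ∀ ω ∈ torusLattice (t * I), ∀ z, z + ω ∈ Z → z ∈ Z := by
    rintro ω hω z (h | h)
    · exact Or.inl (by rwa [mem_ofPred_eq, hperL ω hω] at h)
    · exact Or.inr (by simpa using Submodule.sub_mem _ h hω)
  -- The real and imaginary parts of points of `Z` form countable sets, so a corner can be chosen
  -- for which no edge meets a zero, a pole or a lattice point.
  obtain ⟨x₀, hx₀⟩ := ((hZc.image re).dense_compl ℝ).nonempty
  obtain ⟨y₀, hy₀⟩ := ((hZc.image im).dense_compl ℝ).nonempty
  have hre : ∀ u ∈ Z, u.re ≠ x₀ := fun u hu h => hx₀ ⟨u, hu, h⟩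
  have him : ∀ u ∈ Z, u.im ≠ y₀ := fun u hu h => hy₀ ⟨u, hu, h⟩
  have h1L : -1 ∈ torusLattice (t * I) := mem_torusLattice.2 ⟨-1, 0, by simp⟩
  have hτL : -(t * I) ∈ torusLattice (t * I) := mem_torusLattice.2 ⟨0, -1, by simp⟩
  have hre' : ∀ u ∈ Z, u.re ≠ x₀ + 1 := fun u hu h =>
    hre (u + -1) (hZper 1 (by simpa using Submodule.neg_mem _ h1L) _ (by simpa using hu)) (by simp [h])
  have him' : ∀ u ∈ Z, u.im ≠ y₀ + t := fun u hu h =>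
    him (u + -(t * I)) (hZper (t * I) (by simpa using Submodule.neg_mem _ hτL) _ (by simpa using hu))
      (by simp [h])
  set z₀ : ℂ := ⟨x₀, y₀⟩ with hz₀
  set w₀ : ℂ := ⟨x₀ + 1, y₀ + t⟩ with hw₀
  set K : Set ℂ := uIcc z₀.re w₀.re ×ℂ uIcc z₀.im w₀.im with hK
  have hKm : ∀ u, u ∈ K ↔ (x₀ ≤ u.re ∧ u.re ≤ x₀ + 1) ∧ y₀ ≤ u.im ∧ u.im ≤ y₀ + t := fun u => by
    simp only [hK, mem_reProdIm, hz₀, hw₀]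
    rw [uIcc_of_le (by linarith), uIcc_of_le (by linarith), mem_Icc, mem_Icc]
  have hKc : IsCompact K := isCompact_uIcc.reProdIm isCompact_uIcc
  have hmK : MeromorphicOn f K := fun u _ => hmer u
  set S : Finset ℂ := ((MeromorphicOn.divisor f K).finiteSupport hKc).toFinset with hS
  have hSm : ∀ u, u ∈ S ↔ u ∈ K ∧ meromorphicOrderAt f u ≠ 0 := fun u => by
    rw [hS, Finite.mem_toFinset, Function.mem_support]
    constructor
    · intro h
      have huK := (MeromorphicOn.divisor f K).supportWithinDomain h
      rw [MeromorphicOn.divisor_apply hmK huK] at h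
      exact ⟨huK, fun h' => h (by simp [h'])⟩
    · rintro ⟨huK, h⟩
      rw [MeromorphicOn.divisor_apply hmK huK]
      simp [h, htop u]
  have hSint : ∀ a ∈ S, (x₀ < a.re ∧ a.re < x₀ + 1) ∧ y₀ < a.im ∧ a.im < y₀ + t := by
    intro a ha
    obtain ⟨haK, ha⟩ := (hSm a).1 ha
    obtain ⟨⟨a1, a2⟩, a3, a4⟩ := (hKm a).1 haK
    have haZ : a ∈ Z := Or.inl ha
    exact ⟨⟨a1.lt_of_ne' (hre a haZ), a2.lt_of_ne (hre' a haZ)⟩,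
      a3.lt_of_ne' (him a haZ), a4.lt_of_ne (him' a haZ)⟩
  have hsumS : ∑ a ∈ S, (meromorphicOrderAt f a).untop₀ = 0 := by
    have := sum_residues_eq_zero (g := logDeriv f) (z := z₀) (w := w₀) hmer.logDeriv
      (by simpa [hz₀, hw₀] using per1.logDeriv) (by simpa [hz₀, hw₀] using perτ.logDeriv) ?_ S hSint
      (fun a => ((meromorphicOrderAt f a).untop₀ : ℂ)) ?_
    · exact_mod_cast this
    · rintro u ⟨-, hu⟩
      have huZ : u ∉ Z := fun h => by
        rcases hu with h' | h' | h' | h'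
        exacts [him u h h', him' u h h', hre' u h h', hre u h h']
      simp only [hZ, mem_union, mem_ofPred_eq, not_or, not_not] at huZ
      have hu1 := han u huZ.2
      have hu2 : f u ≠ 0 := by
        have := huZ.1
        rwa [hu1.meromorphicNFAt.meromorphicOrderAt_eq_zero_iff] at this
      exact (hu1.deriv.div hu1 hu2).continuousAt
    · intro u hu
      -- Only the term at `u` matters near `u`; the remaining ones are analytic there. If `u ∉ S`,
      -- the order at `u` is zero and so is the added term.
      have hsplit : (fun v => logDeriv f v -
            ∑ a ∈ S, ((meromorphicOrderAt f a).untop₀ : ℂ) * (v - a)⁻¹) =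
          (fun v => logDeriv f v - ((meromorphicOrderAt f u).untop₀ : ℂ) * (v - u)⁻¹) +
          fun v => -∑ a ∈ S.erase u, ((meromorphicOrderAt f a).untop₀ : ℂ) * (v - a)⁻¹ := by
        funext v
        simp only [Pi.add_apply]
        by_cases huS : u ∈ S
        · rw [← Finset.add_sum_erase S _ huS]
          ring
        · have : meromorphicOrderAt f u = 0 := by
            by_contra h
            exact huS ((hSm u).2 ⟨hu, h⟩)
          rw [Finset.erase_eq_of_notMem huS, this]
          simp [sub_eq_add_neg]
      have hB : AnalyticAt ℂ
          (fun v => -∑ a ∈ S.erase u, ((meromorphicOrderAt f a).untop₀ : ℂ) * (v - a)⁻¹) u := by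
        refine AnalyticAt.neg (Finset.analyticAt_fun_sum _ fun a ha => analyticAt_const.mul
          (AnalyticAt.inv (by fun_prop) (sub_ne_zero.2 (Finset.ne_of_mem_erase ha).symm)))
      rw [hsplit]
      refine le_trans (le_min (meromorphicOrderAt_logDeriv_sub_nonneg (hmer u) (htop u))
        hB.meromorphicOrderAt_nonneg) (meromorphicOrderAt_add ?_ hB.meromorphicAt)
      have := (hmer u).logDeriv
      fun_prop
  set r := rectMod z₀ ht with hr
  have hrord : ∀ z, meromorphicOrderAt f (r z) = meromorphicOrderAt f z := fun z => by
    rw [← hperL _ (sub_rectMod_mem z₀ ht z) (r z), hr, add_sub_cancel]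
  have hrK : ∀ z, r z ∈ K := fun z => by
    obtain ⟨⟨h1, h2⟩, h3, h4⟩ := rectMod_mem z₀ ht z
    exact (hKm _).2 ⟨⟨h1, h2.le⟩, h3, h4.le⟩
  have hinj : InjOn r T := fun a ha b hb hab => by
    refine hTinj a ha b hb ?_
    have := Submodule.sub_mem _ (sub_rectMod_mem z₀ ht a) (sub_rectMod_mem z₀ ht b)
    rw [← hr, hab] at this
    simpa using this
  set U : Finset ℂ := insert (r 0) (S ∪ T.image r) with hU
  have hUK : ∀ u ∈ U, u ∈ K := by
    intro u hu
    simp only [hU, Finset.mem_insert, Finset.mem_union, Finset.mem_image] at hu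
    rcases hu with rfl | hu | ⟨a, -, rfl⟩
    exacts [hrK 0, ((hSm u).1 hu).1, hrK a]
  have hrU : ∀ u ∈ U, r u = u := by
    intro u hu
    refine rectMod_eq_self ht ?_
    simp only [hU, Finset.mem_insert, Finset.mem_union, Finset.mem_image] at hu
    rcases hu with rfl | hu | ⟨a, -, rfl⟩
    · exact rectMod_mem z₀ ht 0
    · obtain ⟨⟨h1, h2⟩, h3, h4⟩ := hSint u hu
      exact ⟨⟨h1.le, h2⟩, h3.le, h4⟩
    · exact rectMod_mem z₀ ht a
  have hsumU : ∑ a ∈ U, (meromorphicOrderAt f a).untop₀ = 0 := by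
    rw [← hsumS]
    refine (Finset.sum_subset (fun a ha => by simp [hU, ha]) fun a haU haS => ?_).symm
    have : meromorphicOrderAt f a = 0 := by
      by_contra h
      exact haS ((hSm a).2 ⟨hUK a haU, h⟩)
    simp [this]
  have hnonneg : ∀ z, z ∉ torusLattice (t * I) → 0 ≤ (meromorphicOrderAt f z).untop₀ := fun z hz => by
    have := (han z hz).meromorphicOrderAt_nonneg
    lift meromorphicOrderAt f z to ℤ using htop z with n
    exact_mod_cast this
  have hle : ∑ a ∈ T.image r, (meromorphicOrderAt f a).untop₀ ≤
      ∑ a ∈ U.erase (r 0), (meromorphicOrderAt f a).untop₀ := by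
    refine Finset.sum_le_sum_of_subset_of_nonneg ?_ ?_
    · intro u hu
      refine Finset.mem_erase.2 ⟨?_, by simp only [hU, Finset.mem_insert, Finset.mem_union, hu, or_true]⟩
      rintro rfl
      obtain ⟨a, ha, har⟩ := Finset.mem_image.1 hu
      have := Submodule.sub_mem _ (sub_rectMod_mem z₀ ht a) (sub_rectMod_mem z₀ ht 0)
      rw [← hr, har] at this
      exact hT a ha (by simpa using this)
    · intro u hu _
      refine hnonneg u fun huL => ?_
      obtain ⟨hne, huU⟩ := Finset.mem_erase.1 hu
      refine hne ?_
      rw [← hrU u huU]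
      exact rectMod_eq_of_sub_mem ht (by simpa using Submodule.neg_mem _ huL)
  have h0' : -(N : ℤ) ≤ (meromorphicOrderAt f (r 0)).untop₀ := by
    rw [hrord 0]
    lift meromorphicOrderAt f 0 to ℤ using htop 0 with n
    exact_mod_cast h0
  have := Finset.add_sum_erase U (fun a => (meromorphicOrderAt f a).untop₀)
    (Finset.mem_insert_self (r 0) _)
  rw [hsumU] at this
  rw [Finset.sum_image hinj] at hle
  simp only [hrord] at hle
  linarith

theorem eq_im_mul_I {τ : ℂ} (h : τ.re = 0) : τ = τ.im * I := by
  apply Complex.ext <;> simp [h]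

/-- For a period `τ` on the imaginary axis one of `τ` and `-τ` lies in the upper half plane. -/
theorem exists_pos_eq_mul_I {τ : ℂ} (h : τ.re = 0) (h0 : τ ≠ 0) :
    ∃ t : ℝ, 0 < t ∧ (τ = t * I ∨ -τ = t * I) := by
  have hτ := eq_im_mul_I h
  have him : τ.im ≠ 0 := fun hi => h0 (by rw [hτ, hi]; simp)
  rcases him.lt_or_gt with hlt | hgt
  · exact ⟨-τ.im, by linarith, Or.inr (by rw [hτ]; simp)⟩
  · exact ⟨τ.im, hgt, Or.inl hτ⟩

/-- A function on the torus whose only pole is a pole of order at most `N` at the origin has at most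
`N` zeros, counted with multiplicity. -/
theorem sum_meromorphicOrderAt_le {τ : ℂ} (hτ : τ.re = 0) (hτ0 : τ ≠ 0) {N : ℕ} {f : ℂ → ℂ}
    (hf : f ∈ ellipticSpace τ N) {u₀ : ℂ} (hu₀ : meromorphicOrderAt f u₀ ≠ ⊤) (T : Finset ℂ)
    (hT : ∀ a ∈ T, a ∉ torusLattice τ)
    (hTinj : ∀ a ∈ T, ∀ b ∈ T, a - b ∈ torusLattice τ → a = b) :
    ∑ a ∈ T, (meromorphicOrderAt f a).untop₀ ≤ N := by
  obtain ⟨t, ht, h | h⟩ := exists_pos_eq_mul_I hτ hτ0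
  · subst h
    exact sum_meromorphicOrderAt_le_of_pos ht hf hu₀ T hT hTinj
  · rw [← ellipticSpace_neg, h] at hf
    simp only [← torusLattice_neg τ, h] at hT hTinj
    exact sum_meromorphicOrderAt_le_of_pos ht hf hu₀ T hT hTinj

theorem eq_zero_of_mem_torusLattice {t : ℝ} (ht : 0 < t) {z : ℂ} (hz : z ∈ torusLattice (t * I))
    (h1 : |z.re| < 1) (h2 : |z.im| < t) : z = 0 := by
  have h0 : (0 : ℂ) - z ∈ torusLattice (t * I) := by simpa using Submodule.neg_mem _ hz
  obtain ⟨m, n, rfl⟩ := mem_torusLattice.1 hz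
  simp at h1 h2
  have hm : m = 0 := by
    have : |m| < 1 := by exact_mod_cast h1
    simpa using this
  have hn : n = 0 := by
    rw [abs_of_pos ht] at h2
    have h3 : |(n : ℝ)| < 1 := by
      by_contra hge
      nlinarith
    have : |n| < 1 := by exact_mod_cast h3
    simpa using this
  simp [hm, hn]

/-- There is no function on the torus with a single simple pole. -/
theorem ellipticSpace_one_le {τ : ℂ} (hτ : τ.re = 0) (hτ0 : τ ≠ 0) :
    ellipticSpace τ 1 ≤ ellipticSpace τ 0 := by
  obtain ⟨t, ht, h⟩ := exists_pos_eq_mul_I hτ hτ0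
  wlog hτt : τ = t * I generalizing τ with H
  · rw [← ellipticSpace_neg τ 0, ← ellipticSpace_neg τ 1]
    have hn := h.resolve_left hτt
    exact H (by simpa using hτ) (by simpa using hτ0) (Or.inl hn) hn
  subst hτt
  rintro f hf
  obtain ⟨per1, perτ, hmer, han, h0⟩ := id hf
  -- The limit `c` of `z * f z` at the origin is the residue of `f`.
  set F : ℂ → ℂ := fun z => z * f z with hF
  have hFm : Meromorphic F := fun z => (MeromorphicAt.id z).mul (hmer z)
  have hF0 : 0 ≤ meromorphicOrderAt F 0 := by
    have : meromorphicOrderAt F 0 = 1 + meromorphicOrderAt f 0 := by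
      have := meromorphicOrderAt_mul (MeromorphicAt.id (𝕜 := ℂ) 0) (hmer 0)
      rwa [meromorphicOrderAt_id] at this
    rw [this]
    calc (0 : WithTop ℤ) = 1 + ((-((1 : ℕ) : ℤ) : ℤ) : WithTop ℤ) := by rfl
      _ ≤ _ := by gcongr
  obtain ⟨c, hc⟩ := tendsto_nhds_of_meromorphicOrderAt_nonneg (hFm 0) hF0
  have hsub : 0 ≤ meromorphicOrderAt (fun v => f v - c * v⁻¹) 0 := by
    have hm : MeromorphicAt (fun v => f v - c * v⁻¹) 0 := by
      have := hmer 0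
      fun_prop
    have hpos : 0 < meromorphicOrderAt (fun v => v * (f v - c * v⁻¹)) 0 := by
      refine (tendsto_zero_iff_meromorphicOrderAt_pos ((MeromorphicAt.id 0).mul hm)).1 ?_
      have : Tendsto (fun v => F v - c) (𝓝[≠] 0) (𝓝 0) := by simpa using hc.sub_const c
      refine this.congr' ?_
      filter_upwards [self_mem_nhdsWithin] with v hv
      have hv : v ≠ 0 := hv
      simp only [hF, Pi.mul_apply]
      field_simp
    have := meromorphicOrderAt_mul (MeromorphicAt.id (𝕜 := ℂ) 0) hm
    rw [meromorphicOrderAt_id] at this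
    have h2 : meromorphicOrderAt (fun v => v * (f v - c * v⁻¹)) 0 =
      1 + meromorphicOrderAt (fun v => f v - c * v⁻¹) 0 := this
    rw [h2] at hpos
    cases hh : meromorphicOrderAt (fun v => f v - c * v⁻¹) 0 with
    | top => exact le_top
    | coe n =>
      rw [hh] at hpos
      have : 0 < 1 + n := by exact_mod_cast hpos
      have : 0 ≤ n := by omega
      exact_mod_cast this
  -- In the rectangle centred at the origin the only lattice point is the origin, so the sum of
  -- residues is `c`.
  have hc0 : c = 0 := by
    have := sum_residues_eq_zero (g := f) (z := ⟨-(1/2), -(t/2)⟩) (w := ⟨1/2, t/2⟩) hmer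
      (by norm_num; exact per1) (by ring_nf; simpa using perτ) ?_ {0} ?_ (fun _ => c) ?_
    · simpa using this
    · rintro u ⟨hu, hu'⟩
      refine (han u fun huL => ?_).continuousAt
      simp only [mem_reProdIm] at hu hu'
      rw [uIcc_of_le (by linarith), uIcc_of_le (by linarith), mem_Icc, mem_Icc] at hu
      have hu0 := eq_zero_of_mem_torusLattice ht huL (by rw [abs_lt]; constructor <;> linarith)
        (by rw [abs_lt]; constructor <;> linarith)
      subst hu0
      simp at hu'
      rcases hu' with h | h <;> linarith
    · simp [ht]
    · intro u hu
      simp only [Finset.sum_singleton, sub_zero]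
      by_cases hu0 : u = 0
      · rw [hu0]; exact hsub
      · have : AnalyticAt ℂ (fun v => f v - c * v⁻¹) u := by
          refine (han u fun huL => hu0 ?_).sub (analyticAt_const.mul (analyticAt_id.inv hu0))
          simp only [mem_reProdIm] at hu
          rw [uIcc_of_le (by linarith), uIcc_of_le (by linarith), mem_Icc, mem_Icc] at hu
          exact eq_zero_of_mem_torusLattice ht huL (by rw [abs_lt]; constructor <;> linarith)
            (by rw [abs_lt]; constructor <;> linarith)
        exact this.meromorphicOrderAt_nonneg
  refine ⟨per1, perτ, hmer, han, ?_⟩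
  simpa [hc0] using hsub

end Valence

/-! ### Elliptic polynomials span the function spaces. -/

section Span

theorem meromorphicOrderAt_pow_mul {f : ℂ → ℂ} (hf : MeromorphicAt f 0) (n : ℕ) :
    meromorphicOrderAt (fun z => z ^ n * f z) 0 = (n : ℤ) + meromorphicOrderAt f 0 := by
  have hid := MeromorphicAt.id (𝕜 := ℂ) 0
  have := meromorphicOrderAt_mul (hid.pow n) hf
  rw [meromorphicOrderAt_pow hid, meromorphicOrderAt_id] at this
  simpa using! this

theorem mem_ellipticSpace_of_tendsto_zero {τ : ℂ} {n : ℕ} {f : ℂ → ℂ} (hf : f ∈ ellipticSpace τ (n + 1))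
    (h : Tendsto (fun z => z ^ (n + 1) * f z) (𝓝[≠] 0) (𝓝 0)) : f ∈ ellipticSpace τ n := by
  obtain ⟨f1, f2, f3, f4, f5⟩ := hf
  refine ⟨f1, f2, f3, f4, ?_⟩
  have hm : MeromorphicAt (fun z => z ^ (n + 1) * f z) 0 :=
    ((MeromorphicAt.id (𝕜 := ℂ) 0).pow (n + 1)).mul (f3 0)
  have hpos := (tendsto_zero_iff_meromorphicOrderAt_pos hm).1 h
  rw [meromorphicOrderAt_pow_mul (f3 0)] at hpos
  cases hh : meromorphicOrderAt f 0 with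
  | top => exact le_top
  | coe k =>
    rw [hh] at hpos
    have : 0 < ((n + 1 : ℕ) : ℤ) + k := by exact_mod_cast hpos
    have : -(n : ℤ) ≤ k := by push_cast at this; omega
    exact_mod_cast this

theorem exists_tendsto_pow_mul {τ : ℂ} {n : ℕ} {f : ℂ → ℂ} (hf : f ∈ ellipticSpace τ n) :
    ∃ l, Tendsto (fun z => z ^ n * f z) (𝓝[≠] 0) (𝓝 l) := by
  obtain ⟨f1, f2, f3, f4, f5⟩ := hf
  refine tendsto_nhds_of_meromorphicOrderAt_nonneg
    (((MeromorphicAt.id (𝕜 := ℂ) 0).pow n).mul (f3 0)) ?_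
  have := meromorphicOrderAt_pow_mul (f3 0) n
  refine le_of_le_of_eq ?_ this.symm
  cases hh : meromorphicOrderAt f 0 with
  | top => simp
  | coe k =>
    rw [hh] at f5
    have : -(n : ℤ) ≤ k := by exact_mod_cast f5
    have : 0 ≤ (n : ℤ) + k := by omega
    exact_mod_cast this

theorem const_mem_ellipticSpace {τ : ℂ} (c : ℂ) (n : ℕ) : (fun _ => c) ∈ ellipticSpace τ n := by
  refine ⟨fun _ => rfl, fun _ => rfl, Meromorphic.const c, fun _ _ => analyticAt_const, ?_⟩
  refine le_trans ?_ (analyticAt_const (v := c)).meromorphicOrderAt_nonneg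
  exact_mod_cast neg_nonpos.2 (Int.natCast_nonneg n)

theorem one_le_untop_meromorphicOrderAt {f : ℂ → ℂ} {z : ℂ} (hf : AnalyticAt ℂ f z) (hz : f z = 0)
    (h : meromorphicOrderAt f z ≠ ⊤) : 1 ≤ (meromorphicOrderAt f z).untop₀ := by
  have h0 : 0 ≤ meromorphicOrderAt f z := hf.meromorphicOrderAt_nonneg
  have h1 : meromorphicOrderAt f z ≠ 0 := fun h' =>
    hf.meromorphicNFAt.meromorphicOrderAt_eq_zero_iff.1 h' hz
  lift meromorphicOrderAt f z to ℤ using h with k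
  have h0 : 0 ≤ k := by exact_mod_cast h0
  have h1 : k ≠ 0 := by exact_mod_cast h1
  simp only [WithTop.untop₀_coe]
  omega

theorem apply_eq_zero_of_meromorphicOrderAt_eq_top {τ : ℂ} {N : ℕ} {f : ℂ → ℂ}
    (hf : f ∈ ellipticSpace τ N)
    {u z : ℂ} (hu : meromorphicOrderAt f u = ⊤) (hz : z ∉ torusLattice τ) : f z = 0 := by
  have htop : meromorphicOrderAt f z = ⊤ := by
    by_contra h
    exact meromorphicOrderAt_ne_top_of_mem_ellipticSpace hf h u hu
  by_contra h
  have := (hf.2.2.2.1 z hz).meromorphicNFAt.meromorphicOrderAt_eq_zero_iff.2 h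
  simp [htop] at this

/-- Liouville on the torus: `f - f z'` has a zero at `z'` and no pole to balance it, so it vanishes
identically. -/
theorem apply_eq_apply_of_mem_ellipticSpace_zero {τ : ℂ} (hτ : τ.re = 0) (hτ0 : τ ≠ 0) {f : ℂ → ℂ}
    (hf : f ∈ ellipticSpace τ 0) {z z' : ℂ}
    (hz : z ∉ torusLattice τ) (hz' : z' ∉ torusLattice τ) : f z = f z' := by
  set g : ℂ → ℂ := f - fun _ => f z' with hg
  have hgm : g ∈ ellipticSpace τ 0 := Submodule.sub_mem _ hf (const_mem_ellipticSpace _ _)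
  have htop : meromorphicOrderAt g z' = ⊤ := by
    by_contra h
    have h1 := sum_meromorphicOrderAt_le hτ hτ0 hgm h {z'} (by simpa using hz') (by simp)
    have h2 := one_le_untop_meromorphicOrderAt (hgm.2.2.2.1 z' hz') (by simp [hg]) h
    simp at h1
    omega
  have := apply_eq_zero_of_meromorphicOrderAt_eq_top hgm htop hz
  simpa [hg, sub_eq_zero] using this

theorem apply_ne_zero_of_isEllipticPolynomial_zero {τ : ℂ} (hτ : τ.re = 0) (hτ0 : τ ≠ 0) {f : ℂ → ℂ}
    (hf : IsEllipticPolynomial τ 0 f)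
    {z : ℂ} (hz : z ∉ torusLattice τ) : f z ≠ 0 := fun h => by
  have htop := meromorphicOrderAt_ne_top_of_mem_ellipticSpace hf.mem_ellipticSpace
    (u := 0) (by simp [hf.order_zero]) z
  have h1 := sum_meromorphicOrderAt_le hτ hτ0 hf.mem_ellipticSpace htop {z} (by simpa using hz)
    (by simp)
  have h2 := one_le_untop_meromorphicOrderAt (hf.analyticAt z hz) h htop
  simp at h1
  omega

theorem half_add_notMem_torusLattice {τ : ℂ} (hτ : τ.re = 0) (hτ0 : τ ≠ 0) (x : ℝ) : τ / 2 + x ∉ torusLattice τ := fun h => by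
  obtain ⟨m, n, h⟩ := mem_torusLattice.1 h
  have him : τ.im ≠ 0 := fun hi => hτ0 (Complex.ext hτ hi)
  have := congrArg Complex.im h
  simp at this
  have : (2 * n : ℝ) = 1 := by
    field_simp at this
    linarith
  have : 2 * n = 1 := by exact_mod_cast this
  omega

theorem eq_of_sub_mem_torusLattice {τ : ℂ} (hτ : τ.re = 0) {x y : ℝ}
    (hx : x ∈ Set.Ico (0 : ℝ) 1) (hy : y ∈ Set.Ico (0 : ℝ) 1) (h : (τ / 2 + x) - (τ / 2 + y) ∈ torusLattice τ) : x = y := by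
  obtain ⟨m, n, h⟩ := mem_torusLattice.1 h
  have := congrArg Complex.re h
  simp [hτ] at this
  have hm : |m| < 1 := by
    have : |(m : ℝ)| < 1 := by
      rw [this, abs_lt]
      exact ⟨by linarith [hx.1, hy.2], by linarith [hx.2, hy.1]⟩
    exact_mod_cast this
  have hm : m = 0 := by simpa using hm
  simp [hm] at this
  linarith

theorem eventually_notMem_torusLattice {τ : ℂ} (hτ : τ.re = 0) (hτ0 : τ ≠ 0) :
    ∀ᶠ z in 𝓝[≠] (0 : ℂ), z ∉ torusLattice τ := by
  obtain ⟨t, ht, h⟩ := exists_pos_eq_mul_I hτ hτ0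
  have hL : torusLattice τ = torusLattice (t * Complex.I) := by
    rcases h with h | h
    · rw [h]
    · rw [← h, torusLattice_neg]
  have h1 : ∀ᶠ z : ℂ in 𝓝 0, |z.re| < 1 :=
    (Complex.continuous_re.abs.tendsto 0).eventually_lt_const (by simp)
  have h2 : ∀ᶠ z : ℂ in 𝓝 0, |z.im| < t :=
    (Complex.continuous_im.abs.tendsto 0).eventually_lt_const (by simpa using ht)
  filter_upwards [h1.filter_mono nhdsWithin_le_nhds, h2.filter_mono nhdsWithin_le_nhds,
    self_mem_nhdsWithin] with z hz1 hz2 hz hzL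
  exact hz (eq_zero_of_mem_torusLattice ht (hL ▸ hzL) hz1 hz2)

/-- Elliptic polynomials of all the degrees `0, 2, 3, …` span the spaces `ellipticSpace τ N`, as
functions on the complement of the lattice. -/
theorem exists_eq_sum_of_mem_ellipticSpace {τ : ℂ} (hτ : τ.re = 0) (hτ0 : τ ≠ 0)
    {π : ℕ → ℂ → ℂ}
    (hell : ∀ n, n ≠ 1 → IsEllipticPolynomial τ n (π n))
    (hlead : ∀ n, n ≠ 1 → ∃ κ : ℂ, κ ≠ 0 ∧ Tendsto (fun z => z ^ n * π n z) (𝓝[≠] 0) (𝓝 κ))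
    (N : ℕ) : ∀ f ∈ ellipticSpace τ N, ∃ c : ℕ → ℂ, ∀ z, z ∉ torusLattice τ →
      f z = ∑ m ∈ (Finset.range (N + 1)).erase 1, c m * π m z := by
  induction N with
  | zero =>
    intro f hf
    have hγ := half_add_notMem_torusLattice hτ hτ0 0
    have h0 := hell 0 (by simp)
    refine ⟨fun _ => f (τ / 2 + (0 : ℝ)) / π 0 (τ / 2 + (0 : ℝ)), fun z hz => ?_⟩
    have hr : (Finset.range (0 + 1)).erase 1 = {0} := by decide
    rw [hr, Finset.sum_singleton, apply_eq_apply_of_mem_ellipticSpace_zero hτ hτ0 hf hz hγ,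
      apply_eq_apply_of_mem_ellipticSpace_zero hτ hτ0 h0.mem_ellipticSpace hz hγ,
      div_mul_cancel₀ _ (apply_ne_zero_of_isEllipticPolynomial_zero hτ hτ0 h0 hγ)]
  | succ N ih =>
    intro f hf
    -- Passing from degree zero to degree one adds nothing, as a single simple pole is impossible;
    -- this is why the index `1` can be omitted.
    rcases Nat.eq_zero_or_pos N with rfl | hN
    · obtain ⟨c, hc⟩ := ih f (ellipticSpace_one_le hτ hτ0 hf)
      exact ⟨c, fun z hz => by rw [hc z hz]; rfl⟩
    obtain ⟨l, hl⟩ := exists_tendsto_pow_mul hf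
    obtain ⟨κ, hκ, hκl⟩ := hlead (N + 1) (by omega)
    have hmem : f - (l / κ) • π (N + 1) ∈ ellipticSpace τ N := by
      refine mem_ellipticSpace_of_tendsto_zero (Submodule.sub_mem _ hf
        (Submodule.smul_mem _ _ (hell (N + 1) (by omega)).mem_ellipticSpace)) ?_
      have := hl.sub (hκl.const_mul (l / κ))
      rw [div_mul_cancel₀ _ hκ, sub_self] at this
      refine this.congr fun z => ?_
      simp only [Pi.sub_apply, Pi.smul_apply, smul_eq_mul]
      ring
    obtain ⟨c, hc⟩ := ih _ hmem
    refine ⟨Function.update c (N + 1) (l / κ), fun z hz => ?_⟩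
    have hne : ∀ m ∈ (Finset.range (N + 1)).erase 1, m ≠ N + 1 := fun m hm => by
      simp at hm; omega
    rw [Finset.range_add_one (n := N + 1), Finset.erase_insert_of_ne (by omega),
      Finset.sum_insert (by simp), Function.update_self,
      Finset.sum_congr rfl fun m hm => by rw [Function.update_of_ne (hne m hm)], ← hc z hz]
    simp

/-- A vanishing leading coefficient lowers the degree by one; in degree zero it forces the constant
to vanish. -/
theorem exists_eq_sum_of_tendsto_zero {τ : ℂ} (hτ : τ.re = 0) (hτ0 : τ ≠ 0)
    {π : ℕ → ℂ → ℂ}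
    (hell : ∀ n, n ≠ 1 → IsEllipticPolynomial τ n (π n))
    (hlead : ∀ n, n ≠ 1 → ∃ κ : ℂ, κ ≠ 0 ∧ Tendsto (fun z => z ^ n * π n z) (𝓝[≠] 0) (𝓝 κ))
    {n : ℕ} {f : ℂ → ℂ} (hf : f ∈ ellipticSpace τ n)
    (h0 : Tendsto (fun z => z ^ n * f z) (𝓝[≠] 0) (𝓝 0)) :
    ∃ c : ℕ → ℂ, ∀ z, z ∉ torusLattice τ →
      f z = ∑ m ∈ (Finset.range n).erase 1, c m * π m z := by
  rcases n with _ | n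
  · refine ⟨0, fun z hz => ?_⟩
    have : Tendsto (fun z => z ^ 0 * f z) (𝓝[≠] 0) (𝓝 (f z)) := by
      refine tendsto_const_nhds.congr' ?_
      filter_upwards [eventually_notMem_torusLattice hτ hτ0] with u hu
      rw [apply_eq_apply_of_mem_ellipticSpace_zero hτ hτ0 hf hz hu, pow_zero, one_mul]
    simpa using tendsto_nhds_unique this h0
  · exact exists_eq_sum_of_mem_ellipticSpace hτ hτ0 hell hlead n f
      (mem_ellipticSpace_of_tendsto_zero hf h0)

end Span

/-! ### Sign changes of real-valued analytic functions on a line. -/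

section Sign

theorem tendsto_add_ofReal_nhdsNE (c : ℂ) (x : ℝ) :
    Tendsto (fun s : ℝ => c + (s : ℂ)) (𝓝[≠] x) (𝓝[≠] (c + x)) := by
  refine tendsto_nhdsWithin_iff.2 ⟨?_, ?_⟩
  · exact (Continuous.tendsto (by fun_prop) x).mono_left nhdsWithin_le_nhds
  · filter_upwards [self_mem_nhdsWithin] with s hs h
    exact hs (by simpa using h)

theorem eventually_apply_add_ofReal_ne_zero {F : ℂ → ℂ} {c : ℂ} {x : ℝ}
    (hF : AnalyticAt ℂ F (c + x)) (h : analyticOrderAt F (c + x) ≠ ⊤) :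
    ∀ᶠ s : ℝ in 𝓝[≠] x, F (c + s) ≠ 0 := by
  refine (tendsto_add_ofReal_nhdsNE c x).eventually (hF.eventually_eq_zero_or_eventually_ne_zero.resolve_left ?_)
  rwa [← analyticOrderAt_eq_top]

/-- An analytic function which is real on the line `c + ℝ` has constant sign on each side of, and
near, a zero of even order on this line. -/
theorem eventually_pos_or_eventually_neg {F : ℂ → ℂ} {c : ℂ} (him : ∀ x : ℝ, (F (c + x)).im = 0)
    {x : ℝ} (hF : AnalyticAt ℂ F (c + x)) {m : ℕ} (hm : analyticOrderAt F (c + x) = (2 * m : ℕ)) :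
    (∀ᶠ s : ℝ in 𝓝[≠] x, 0 < (F (c + s)).re) ∨ ∀ᶠ s : ℝ in 𝓝[≠] x, (F (c + s)).re < 0 := by
  -- With the factor `(s - x) ^ (2 * m)` positive off `x`, the sign is that of `g (c + x)`, which is
  -- real as a limit of real values and nonzero.
  obtain ⟨g, hg, hg0, hFg⟩ := hF.analyticOrderAt_eq_natCast.1 hm
  have hgc : Tendsto (fun s : ℝ => g (c + s)) (𝓝[≠] x) (𝓝 (g (c + x))) :=
    hg.continuousAt.tendsto.comp ((tendsto_add_ofReal_nhdsNE c x).mono_right nhdsWithin_le_nhds)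
  have hrepr : ∀ᶠ s : ℝ in 𝓝[≠] x, F (c + s) = (((s - x) ^ (2 * m) : ℝ) : ℂ) * g (c + s) := by
    filter_upwards [((tendsto_add_ofReal_nhdsNE c x).mono_right nhdsWithin_le_nhds).eventually hFg]
      with s hs
    rw [hs, smul_eq_mul]
    push_cast
    ring_nf
  have hpow : ∀ᶠ s : ℝ in 𝓝[≠] x, 0 < (s - x) ^ (2 * m) := by
    filter_upwards [self_mem_nhdsWithin] with s hs
    rw [pow_mul]
    exact pow_pos (sq_pos_of_ne_zero (sub_ne_zero.2 hs)) m
  have hgim : (g (c + x)).im = 0 := by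
    refine tendsto_nhds_unique ((Complex.continuous_im.tendsto _).comp hgc)
      (tendsto_const_nhds.congr' ?_)
    filter_upwards [hrepr, hpow] with s h1 h2
    have := him s
    rw [h1, Complex.im_ofReal_mul] at this
    exact ((mul_eq_zero.1 this).resolve_left h2.ne').symm
  have hgre : (g (c + x)).re ≠ 0 := fun h => hg0 (Complex.ext h hgim)
  have hgrec : Tendsto (fun s : ℝ => (g (c + s)).re) (𝓝[≠] x) (𝓝 (g (c + x)).re) :=
    (Complex.continuous_re.tendsto _).comp hgc
  rcases hgre.lt_or_gt with h | h
  · right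
    filter_upwards [hrepr, hpow, hgrec.eventually_lt_const h] with s h1 h2 h3
    rw [h1, Complex.re_ofReal_mul]
    exact mul_neg_of_pos_of_neg h2 h3
  · left
    filter_upwards [hrepr, hpow, hgrec.eventually_const_lt h] with s h1 h2 h3
    rw [h1, Complex.re_ofReal_mul]
    exact mul_pos h2 h3

/-- An analytic function which is real on the line `c + ℝ` and has only zeros of even order on this
line does not change sign there. -/
theorem nonneg_or_nonpos_of_even_order {F : ℂ → ℂ} {c : ℂ} (him : ∀ x : ℝ, (F (c + x)).im = 0)
    (hF : ∀ x : ℝ, AnalyticAt ℂ F (c + x))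
    (heven : ∀ x : ℝ, ∃ m : ℕ, analyticOrderAt F (c + x) = (2 * m : ℕ)) :
    (∀ x : ℝ, 0 ≤ (F (c + x)).re) ∨ ∀ x : ℝ, (F (c + x)).re ≤ 0 := by
  set u : ℝ → ℝ := fun s => (F (c + s)).re with hu
  have hcont : ∀ x, ContinuousAt u x := fun x =>
    Complex.continuous_re.continuousAt.comp
      (ContinuousAt.comp (f := fun s : ℝ => c + (s : ℂ)) (hF x).continuousAt (by fun_prop))
  have key : ∀ x, (∀ᶠ s in 𝓝[≠] x, 0 < u s) ∨ ∀ᶠ s in 𝓝[≠] x, u s < 0 := fun x =>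
    (heven x).elim fun m hm => eventually_pos_or_eventually_neg him (hF x) hm
  have hge : ∀ x, (∀ᶠ s in 𝓝[≠] x, 0 < u s) → 0 ≤ u x := fun x h =>
    ge_of_tendsto ((hcont x).tendsto.mono_left nhdsWithin_le_nhds) (h.mono fun _ h => h.le)
  have hle : ∀ x, (∀ᶠ s in 𝓝[≠] x, u s < 0) → u x ≤ 0 := fun x h =>
    le_of_tendsto ((hcont x).tendsto.mono_left nhdsWithin_le_nhds) (h.mono fun _ h => h.le)
  -- Each point has a neighbourhood on which `u` has one weak sign, never both, so `P` and its
  -- complement are both open and connectedness of `ℝ` concludes.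
  set P : Set ℝ := {x | ∀ᶠ s in 𝓝 x, 0 ≤ u s} with hP
  have hPc : Pᶜ = {x | ∀ᶠ s in 𝓝 x, u s ≤ 0} := by
    ext x
    simp only [hP, Set.mem_compl_iff, Set.mem_ofPred_eq]
    constructor
    · intro h
      rcases key x with h' | h'
      · refine absurd ?_ h
        rw [eventually_nhdsWithin_iff] at h'
        filter_upwards [h'] with s hs
        by_cases hsx : s = x
        · rw [hsx]; exact hge x (eventually_nhdsWithin_iff.2 h')
        · exact (hs hsx).le
      · have h'' := h'
        rw [eventually_nhdsWithin_iff] at h'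
        filter_upwards [h'] with s hs
        by_cases hsx : s = x
        · rw [hsx]; exact hle x h''
        · exact (hs hsx).le
    · intro h1 h2
      have h1 := h1.filter_mono (nhdsWithin_le_nhds (s := {x}ᶜ))
      have h2 := h2.filter_mono (nhdsWithin_le_nhds (s := {x}ᶜ))
      rcases key x with h' | h'
      · obtain ⟨s, hs1, hs2⟩ := (h1.and h').exists
        linarith
      · obtain ⟨s, hs1, hs2⟩ := (h2.and h').exists
        linarith
  have hclopen : IsClopen P := by
    refine ⟨⟨?_⟩, isOpen_setOfPred_eventually_nhds⟩
    rw [hPc]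
    exact isOpen_setOfPred_eventually_nhds
  rcases isClopen_iff.1 hclopen with h | h
  · right
    intro x
    have : x ∈ Pᶜ := by simp [h]
    rw [hPc] at this
    exact Eventually.self_of_nhds (p := fun s => u s ≤ 0) this
  · left
    intro x
    have : x ∈ P := by simp [h]
    exact Eventually.self_of_nhds (p := fun s => 0 ≤ u s) this

theorem analyticOrderNatAt_add_fract {F : ℂ → ℂ} {c : ℂ} (hper : Function.Periodic F 1) (x : ℝ) :
    analyticOrderNatAt F (c + x) = analyticOrderNatAt F (c + (Int.fract x : ℝ)) := by
  have h1 : F ∘ (fun z => z - (⌊x⌋ : ℂ)) = F := funext fun z => by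
    simpa using hper.sub_int_mul_eq (x := z) ⌊x⌋
  have h2 := analyticOrderAt_comp_of_deriv_ne_zero (f := F) (g := fun z => z - (⌊x⌋ : ℂ))
    (z₀ := c + x) (by fun_prop) (by simp)
  rw [h1] at h2
  unfold analyticOrderNatAt
  rw [h2]
  congr 2
  rw [← Int.self_sub_floor]
  push_cast
  ring

/-- A `1`-periodic analytic function which is real on the line `c + ℝ` has an even number of zeros of
odd order in a period on this line. -/
theorem even_card_of_odd_order {F : ℂ → ℂ} {c : ℂ} (him : ∀ x : ℝ, (F (c + x)).im = 0)
    (hF : ∀ x : ℝ, AnalyticAt ℂ F (c + x)) (hper : Function.Periodic F 1)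
    (hfin : ∀ x : ℝ, analyticOrderAt F (c + x) ≠ ⊤) (D : Finset ℝ)
    (hD : ∀ x, x ∈ D ↔ x ∈ Set.Ico (0 : ℝ) 1 ∧ Odd (analyticOrderNatAt F (c + x))) :
    Even D.card := by
  classical
  -- On the line this factor has simple zeros exactly at `d + ℤ`, and it changes sign under
  -- translation by one. The product over `D` makes every order of `F * q` even, and `F * q` is
  -- antiperiodic when `D.card` is odd.
  set s : ℝ → ℂ → ℂ := fun d z => Complex.sin (Real.pi * (z - c - d)) with hs
  have hsan : ∀ d z, AnalyticAt ℂ (s d) z := fun d z =>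
    (Complex.differentiable_sin.analyticAt _).comp (g := Complex.sin)
      (f := fun z => (Real.pi : ℂ) * (z - c - d)) (by fun_prop)
  have hsval : ∀ d x : ℝ, s d (c + x) = (Real.sin (Real.pi * (x - d)) : ℂ) := fun d x => by
    simp [hs]
  have hszero : ∀ d ∈ D, ∀ x : ℝ, s d (c + x) = 0 ↔ d = Int.fract x := by
    intro d hd x
    have hd' := ((hD d).1 hd).1
    rw [hsval, Complex.ofReal_eq_zero, Real.sin_eq_zero_iff]
    constructor
    · rintro ⟨n, hn⟩
      have : x - d = n := mul_left_cancel₀ Real.pi_ne_zero (by linarith)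
      exact (Int.fract_eq_iff.2 ⟨hd'.1, hd'.2, n, this⟩).symm
    · rintro rfl
      refine ⟨⌊x⌋, ?_⟩
      rw [Int.self_sub_fract]
      ring
  have hsone : ∀ d x : ℝ, s d (c + x) = 0 → analyticOrderAt (s d) (c + x) = 1 := by
    intro d x h0
    refine AnalyticAt.analyticOrderAt_eq_one_of_zero_deriv_ne_zero (hsan d _) h0 ?_
    have hder : HasDerivAt (s d) (Complex.cos (Real.pi * (c + x - c - d)) * (Real.pi * 1)) (c + x) := by
      refine HasDerivAt.csin (HasDerivAt.const_mul _ ?_)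
      exact ((hasDerivAt_id _).sub_const c).sub_const _
    rw [hder.deriv, mul_one]
    refine mul_ne_zero (fun hc => ?_) (by simp [Real.pi_ne_zero])
    have := Complex.sin_sq_add_cos_sq (Real.pi * (c + x - c - d))
    have h0' : Complex.sin (Real.pi * (c + x - c - d)) = 0 := h0
    rw [h0', hc] at this
    simp at this
  set q : ℂ → ℂ := fun z => ∏ d ∈ D, s d z with hq
  set Q : ℝ → ℝ := fun x => ∏ d ∈ D, Real.sin (Real.pi * (x - d)) with hQ
  have hqQ : ∀ x : ℝ, q (c + x) = (Q x : ℂ) := fun x => by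
    simp only [hq, hQ, hsval, Complex.ofReal_prod]
  have hqan : ∀ z, AnalyticAt ℂ q z := fun z =>
    Finset.analyticAt_fun_prod D fun d _ => hsan d z
  have hFper : ∀ x : ℝ, F (c + (x + 1 : ℝ)) = F (c + x) := fun x => by
    rw [← hper (c + x)]; push_cast; ring_nf
  have hQper : ∀ x : ℝ, Q (x + 1) = (-1) ^ D.card * Q x := fun x => by
    simp only [hQ]
    rw [← Finset.prod_const, ← Finset.prod_mul_distrib]
    refine Finset.prod_congr rfl fun d _ => ?_
    rw [show Real.pi * (x + 1 - d) = Real.pi * (x - d) + Real.pi by ring, Real.sin_add_pi]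
    ring
  have hordF : ∀ x : ℝ, analyticOrderAt F (c + x) = (analyticOrderNatAt F (c + x) : ℕ) := fun x =>
    (Nat.cast_analyticOrderNatAt (hfin x)).symm
  have hordfract := analyticOrderNatAt_add_fract (c := c) hper
  have hG : ∀ x : ℝ, ∃ m : ℕ, analyticOrderAt (fun z => F z * q z) (c + x) = (2 * m : ℕ) := by
    intro x
    have hmul : analyticOrderAt (fun z => F z * q z) (c + x) =
        analyticOrderAt F (c + x) + analyticOrderAt q (c + x) := analyticOrderAt_mul (hF x) (hqan _)
    have hfr : Int.fract x ∈ Set.Ico (0 : ℝ) 1 := ⟨Int.fract_nonneg x, Int.fract_lt_one x⟩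
    by_cases hx : Int.fract x ∈ D
    · have hodd := ((hD _).1 hx).2
      rw [← hordfract] at hodd
      have hsplit : q = s (Int.fract x) * fun z => ∏ d ∈ D.erase (Int.fract x), s d z := by
        funext z
        simp only [hq, Pi.mul_apply]
        exact (Finset.mul_prod_erase D (fun d => s d z) hx).symm
      have hq1 : analyticOrderAt q (c + x) = 1 := by
        have han2 : AnalyticAt ℂ (fun z => ∏ d ∈ D.erase (Int.fract x), s d z) (c + x) :=
          Finset.analyticAt_fun_prod _ fun d _ => hsan d _
        rw [hsplit, analyticOrderAt_mul (hsan _ _) han2,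
          hsone _ _ ((hszero _ hx x).2 rfl), han2.analyticOrderAt_eq_zero.2, add_zero]
        refine Finset.prod_ne_zero_iff.2 fun d hd h0 => ?_
        obtain ⟨hd1, hd2⟩ := Finset.mem_erase.1 hd
        exact hd1 ((hszero d hd2 x).1 h0)
      obtain ⟨k, hk⟩ := hodd
      refine ⟨k + 1, ?_⟩
      rw [hmul, hq1, hordF, hk]
      norm_cast
    · have hev : ¬ Odd (analyticOrderNatAt F (c + x)) := fun h =>
        hx ((hD _).2 ⟨hfr, by rwa [← hordfract]⟩)
      have hq0 : analyticOrderAt q (c + x) = 0 := by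
        rw [(hqan _).analyticOrderAt_eq_zero]
        refine Finset.prod_ne_zero_iff.2 fun d hd h0 => hx ?_
        rwa [← (hszero d hd x).1 h0]
      obtain ⟨k, hk⟩ := (Nat.not_odd_iff_even.1 hev)
      refine ⟨k, ?_⟩
      rw [hmul, hq0, hordF, hk, two_mul, add_zero]
  have hGim : ∀ x : ℝ, (F (c + x) * q (c + x)).im = 0 := fun x => by
    rw [hqQ, Complex.im_mul_ofReal, him, zero_mul]
  by_contra hcard
  have hneg : ∀ x : ℝ, (F (c + (x + 1 : ℝ)) * q (c + (x + 1 : ℝ))).re = -(F (c + x) * q (c + x)).re := by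
    intro x
    rw [hFper, hqQ, hqQ, hQper, (Nat.not_even_iff_odd.1 hcard).neg_one_pow]
    simp
  -- Constant sign together with antiperiodicity forces zero.
  have hzero : ∀ x : ℝ, F (c + x) * q (c + x) = 0 := by
    intro x
    refine Complex.ext ?_ (hGim x)
    rw [Complex.zero_re]
    rcases nonneg_or_nonpos_of_even_order (F := fun z => F z * q z) hGim
      (fun x => (hF x).mul (hqan _)) hG with h | h
    · have h1 := h x
      have h2 := h (x + 1)
      rw [hneg x] at h2
      linarith
    · have h1 := h x
      have h2 := h (x + 1)
      rw [hneg x] at h2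
      linarith
  obtain ⟨m, hm⟩ := hG 0
  obtain ⟨x, hx⟩ := (eventually_apply_add_ofReal_ne_zero (F := fun z => F z * q z)
    ((hF 0).mul (hqan _)) (by rw [hm]; exact ENat.natCast_ne_top _)).exists
  exact hx (hzero x)

end Sign

/-! ### Reflection in the real axis. -/

section Conjugation

open ComplexConjugate

/-- The reflection `z ↦ conj (f (conj z))` of a function. -/
def conjReflect (f : ℂ → ℂ) : ℂ → ℂ := fun z => conj (f (conj z))

theorem AnalyticAt.conjReflect {f : ℂ → ℂ} {z : ℂ} (hf : AnalyticAt ℂ f (conj z)) :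
    AnalyticAt ℂ (conjReflect f) z := by
  rw [Complex.analyticAt_iff_eventually_differentiableAt] at hf ⊢
  have := (Complex.continuous_conj.tendsto z).eventually hf
  filter_upwards [this] with u hu
  have := hu.conj_conj
  rwa [Complex.conj_conj] at this

theorem MeromorphicAt.conjReflect {f : ℂ → ℂ} {z : ℂ} (hf : MeromorphicAt f (conj z)) :
    MeromorphicAt (conjReflect f) z := by
  obtain ⟨n, hn⟩ := hf
  refine ⟨n, hn.conjReflect.congr (Eventually.of_forall fun u => ?_)⟩
  simp [_root_.conjReflect]

theorem tendsto_conj_nhdsNE_zero : Tendsto (conj : ℂ → ℂ) (𝓝[≠] 0) (𝓝[≠] 0) := by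
  refine tendsto_nhdsWithin_iff.2 ⟨?_, ?_⟩
  · simpa using (Complex.continuous_conj.tendsto (0 : ℂ)).mono_left nhdsWithin_le_nhds
  · filter_upwards [self_mem_nhdsWithin] with z hz
    simpa using hz

theorem tendsto_pow_mul_conjReflect {f : ℂ → ℂ} {n : ℕ} {l : ℂ}
    (h : Tendsto (fun z => z ^ n * f z) (𝓝[≠] 0) (𝓝 l)) :
    Tendsto (fun z => z ^ n * conjReflect f z) (𝓝[≠] 0) (𝓝 (conj l)) := by
  refine ((Complex.continuous_conj.tendsto l).comp (h.comp tendsto_conj_nhdsNE_zero)).congr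
    fun z => ?_
  simp [conjReflect]

theorem conjReflect_mem_ellipticSpace {τ : ℂ} (hτ : τ.re = 0) {n : ℕ} {f : ℂ → ℂ}
    (hf : f ∈ ellipticSpace τ n) : conjReflect f ∈ ellipticSpace τ n := by
  obtain ⟨l, hl⟩ := exists_tendsto_pow_mul hf
  obtain ⟨f1, f2, f3, f4, f5⟩ := hf
  have hcτ : conj τ = -τ := by apply Complex.ext <;> simp [hτ]
  have hm : Meromorphic (conjReflect f) := fun z => (f3 _).conjReflect
  refine ⟨fun z => ?_, fun z => ?_, hm, fun z hz => (f4 _ fun h => hz ?_).conjReflect, ?_⟩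
  · simp [conjReflect, f1 (conj z)]
  · simp [conjReflect, hcτ, ← sub_eq_add_neg, f2.sub_eq]
  · obtain ⟨a, b, h⟩ := mem_torusLattice.1 h
    refine mem_torusLattice.2 ⟨a, -b, ?_⟩
    have := congrArg conj h
    simpa [hcτ] using this
  · have h0 := (tendsto_nhds_iff_meromorphicOrderAt_nonneg
      (((MeromorphicAt.id (𝕜 := ℂ) 0).pow n).mul (hm 0))).1 ⟨_, tendsto_pow_mul_conjReflect hl⟩
    rw [show (id ^ n * conjReflect f : ℂ → ℂ) = fun z => z ^ n * conjReflect f z from rfl,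
      meromorphicOrderAt_pow_mul (hm 0)] at h0
    cases hh : meromorphicOrderAt (conjReflect f) 0 with
    | top => exact le_top
    | coe k =>
      rw [hh] at h0
      have : 0 ≤ (n : ℤ) + k := by exact_mod_cast h0
      have : -(n : ℤ) ≤ k := by omega
      exact_mod_cast this

/-- As `τ` is imaginary, conjugation moves a point of `γ` by exactly `-τ`. -/
theorem conjReflect_apply_half_add {τ : ℂ} (hτ : τ.re = 0) {f : ℂ → ℂ}
    (hf : Function.Periodic f τ) (x : ℝ) :
    conjReflect f (τ / 2 + x) = conj (f (τ / 2 + x)) := by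
  have hcτ : conj τ = -τ := by apply Complex.ext <;> simp [hτ]
  have : conj (τ / 2 + (x : ℂ)) + τ = τ / 2 + x := by
    simp only [map_add, map_div₀, hcτ, map_ofNat, Complex.conj_ofReal]
    ring
  calc conj (f (conj (τ / 2 + (x : ℂ)))) = conj (f (conj (τ / 2 + (x : ℂ)) + τ)) := by rw [hf]
    _ = _ := by rw [this]

end Conjugation

/-! ### Linearity and conjugation of the pairing. -/

section Pairing

open ComplexConjugate MeasureTheory

theorem continuous_comp_half_add {τ : ℂ} (hτ : τ.re = 0) (hτ0 : τ ≠ 0) {N : ℕ} {f : ℂ → ℂ}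
    (hf : f ∈ ellipticSpace τ N) : Continuous fun x : ℝ => f (τ / 2 + x) :=
  continuous_iff_continuousAt.2 fun x => ContinuousAt.comp (f := fun s : ℝ => τ / 2 + (s : ℂ))
    (hf.2.2.2.1 _ (half_add_notMem_torusLattice hτ hτ0 x)).continuousAt (by fun_prop)

theorem IsCycleWeight.intervalIntegrable_mul {τ : ℂ} {w : ℂ → ℝ} (hw : IsCycleWeight τ w)
    {f g : ℂ → ℂ} (hf : Continuous fun x : ℝ => f (τ / 2 + x))
    (hg : Continuous fun x : ℝ => g (τ / 2 + x)) :
    IntervalIntegrable (fun x : ℝ => f (τ / 2 + x) * g (τ / 2 + x) * (w (τ / 2 + x) : ℂ))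
      volume 0 1 := by
  have : IntervalIntegrable (fun x : ℝ => (w (τ / 2 + x) : ℂ)) volume 0 1 :=
    ⟨hw.integrable.1.ofReal, hw.integrable.2.ofReal⟩
  exact this.continuousOn_mul (hf.mul hg).continuousOn

theorem cyclePairing_congr_left {τ : ℂ} {w : ℂ → ℝ} {f f' g : ℂ → ℂ}
    (h : ∀ x : ℝ, f (τ / 2 + x) = f' (τ / 2 + x)) :
    cyclePairing τ w f g = cyclePairing τ w f' g := by
  simp only [cyclePairing, h]

theorem cyclePairing_sub_left {τ : ℂ} {w : ℂ → ℝ} (hw : IsCycleWeight τ w) {f f' g : ℂ → ℂ}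
    (hf : Continuous fun x : ℝ => f (τ / 2 + x)) (hf' : Continuous fun x : ℝ => f' (τ / 2 + x))
    (hg : Continuous fun x : ℝ => g (τ / 2 + x)) :
    cyclePairing τ w (f - f') g = cyclePairing τ w f g - cyclePairing τ w f' g := by
  unfold cyclePairing
  rw [← intervalIntegral.integral_sub (hw.intervalIntegrable_mul hf hg)
    (hw.intervalIntegrable_mul hf' hg)]
  refine intervalIntegral.integral_congr fun x _ => ?_
  simp only [Pi.sub_apply]
  ring

theorem cyclePairing_sum_left {τ : ℂ} {w : ℂ → ℝ} (hw : IsCycleWeight τ w) {ι : Type*}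
    (s : Finset ι) (c : ι → ℂ) {f : ι → ℂ → ℂ} {g : ℂ → ℂ}
    (hf : ∀ i ∈ s, Continuous fun x : ℝ => f i (τ / 2 + x))
    (hg : Continuous fun x : ℝ => g (τ / 2 + x)) :
    cyclePairing τ w (fun z => ∑ i ∈ s, c i * f i z) g =
      ∑ i ∈ s, c i * cyclePairing τ w (f i) g := by
  unfold cyclePairing
  simp only [← intervalIntegral.integral_const_mul]
  rw [← intervalIntegral.integral_finsetSum fun i hi =>
    (hw.intervalIntegrable_mul (hf i hi) hg).const_mul (c i)]
  refine intervalIntegral.integral_congr fun x _ => ?_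
  simp only [Finset.sum_mul]
  exact Finset.sum_congr rfl fun i _ => by ring

theorem conj_cyclePairing {τ : ℂ} {w : ℂ → ℝ} {f g f' g' : ℂ → ℂ}
    (hf : ∀ x : ℝ, f' (τ / 2 + x) = conj (f (τ / 2 + x)))
    (hg : ∀ x : ℝ, g' (τ / 2 + x) = conj (g (τ / 2 + x))) :
    cyclePairing τ w f' g' = conj (cyclePairing τ w f g) := by
  simp only [cyclePairing, hf, hg, ← intervalIntegral.intervalIntegral_conj]
  simp

end Pairing

/-! ### Reality of the orthonormal polynomials on the cycle. -/

section Family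

open ComplexConjugate

variable {τ : ℂ} {w : ℂ → ℝ} {π : ℕ → ℂ → ℂ}

theorem IsOrthonormalEOPFamily.tendsto_pow_mul (hπ : IsOrthonormalEOPFamily τ w π) {n : ℕ}
    (hn : n ≠ 1) :
    ∃ κ : ℝ, 0 < κ ∧ Tendsto (fun z => z ^ n * π n z) (𝓝[≠] 0) (𝓝 (κ : ℂ)) := by
  obtain ⟨κ, hκ, h⟩ := hπ.leading n hn
  refine ⟨κ, hκ, ?_⟩
  have h0 : Tendsto (fun z : ℂ => z) (𝓝[≠] 0) (𝓝 0) := tendsto_id.mono_left nhdsWithin_le_nhds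
  simpa using (h.trans_tendsto h0).add_const (κ : ℂ)

theorem IsOrthonormalEOPFamily.continuous (hτ : τ.re = 0) (hτ0 : τ ≠ 0)
    (hπ : IsOrthonormalEOPFamily τ w π) {n : ℕ} (hn : n ≠ 1) :
    Continuous fun x : ℝ => π n (τ / 2 + x) :=
  continuous_comp_half_add hτ hτ0 (hπ.elliptic n hn).mem_ellipticSpace

/-- Pairing a linear combination of orthonormal elliptic polynomials with one of them recovers the
coefficient. -/
theorem IsOrthonormalEOPFamily.cyclePairing_sum (hτ : τ.re = 0) (hτ0 : τ ≠ 0)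
    (hw : IsCycleWeight τ w) (hπ : IsOrthonormalEOPFamily τ w π) {s : Finset ℕ}
    (hs : ∀ m ∈ s, m ≠ 1) (c : ℕ → ℂ) {j : ℕ} (hj : j ≠ 1) :
    cyclePairing τ w (fun z => ∑ m ∈ s, c m * π m z) (π j) = if j ∈ s then c j else 0 := by
  rw [cyclePairing_sum_left hw s c (fun m hm => hπ.continuous hτ hτ0 (hs m hm))
    (hπ.continuous hτ hτ0 hj),
    Finset.sum_congr rfl fun m hm => by rw [hπ.orthonormal m j (hs m hm) hj]]
  simp

/-- The orthonormal elliptic polynomials are real on the cycle `γ`. -/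
theorem IsOrthonormalEOPFamily.conj_apply (hτ : τ.re = 0) (hτ0 : τ ≠ 0) (hw : IsCycleWeight τ w)
    (hπ : IsOrthonormalEOPFamily τ w π) (n : ℕ) (hn : n ≠ 1) (x : ℝ) :
    conj (π n (τ / 2 + x)) = π n (τ / 2 + x) := by
  induction n using Nat.strong_induction_on generalizing x with
  | _ n ih =>
  have hmem := (hπ.elliptic n hn).mem_ellipticSpace
  have hmem' := conjReflect_mem_ellipticSpace hτ hmem
  have hval : ∀ x : ℝ, conjReflect (π n) (τ / 2 + x) = conj (π n (τ / 2 + x)) :=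
    conjReflect_apply_half_add hτ (hπ.elliptic n hn).periodic_tau
  obtain ⟨κ, -, hκ⟩ := hπ.tendsto_pow_mul hn
  have h0 : Tendsto (fun z => z ^ n * (conjReflect (π n) - π n) z) (𝓝[≠] 0) (𝓝 0) := by
    have := (tendsto_pow_mul_conjReflect hκ).sub hκ
    rw [Complex.conj_ofReal, sub_self] at this
    exact this.congr fun z => by simp [mul_sub]
  obtain ⟨c, hc⟩ := exists_eq_sum_of_tendsto_zero hτ hτ0 hπ.elliptic
    (fun m hm => (hπ.tendsto_pow_mul hm).elim fun κ h => ⟨κ, by simpa using h.1.ne', h.2⟩)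
    (Submodule.sub_mem _ hmem' hmem) h0
  have hcγ : ∀ x : ℝ, (conjReflect (π n) - π n) (τ / 2 + x) =
      ∑ m ∈ (Finset.range n).erase 1, c m * π m (τ / 2 + x) := fun x =>
    hc _ (half_add_notMem_torusLattice hτ hτ0 x)
  -- Pairing with `π j`, real on `γ` by induction, turns the reflected term into the conjugate of
  -- the pairing of `π n` with `π j`, which is zero as `j < n`.
  have hc0 : ∀ j ∈ (Finset.range n).erase 1, c j = 0 := by
    intro j hj
    obtain ⟨hj1, hjn⟩ := Finset.mem_erase.1 hj
    have hjn : j < n := by simpa using hjn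
    have h1 := hπ.cyclePairing_sum hτ hτ0 hw (s := (Finset.range n).erase 1)
      (fun m hm => Finset.ne_of_mem_erase hm) c hj1
    rw [if_pos hj, ← cyclePairing_congr_left hcγ, cyclePairing_sub_left hw
      (continuous_comp_half_add hτ hτ0 hmem') (continuous_comp_half_add hτ hτ0 hmem)
      (hπ.continuous hτ hτ0 hj1),
      conj_cyclePairing hval (fun x => (ih j hjn hj1 x).symm), hπ.orthonormal n j hn hj1,
      if_neg hjn.ne'] at h1
    simpa using h1.symm
  have := hcγ x
  rw [Finset.sum_eq_zero fun m hm => by rw [hc0 m hm, zero_mul], Pi.sub_apply, hval, sub_eq_zero]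
    at this
  exact this

theorem IsOrthonormalEOPFamily.im_apply (hτ : τ.re = 0) (hτ0 : τ ≠ 0) (hw : IsCycleWeight τ w)
    (hπ : IsOrthonormalEOPFamily τ w π) {n : ℕ} (hn : n ≠ 1) (x : ℝ) :
    (π n (τ / 2 + x)).im = 0 :=
  Complex.conj_eq_iff_im.1 (hπ.conj_apply hτ hτ0 hw n hn x)

end Family

/-! ### Orders on the cycle and positivity of the integral. -/

section Zeros

open MeasureTheory

/-- At infinite order both sides default to zero, so no finiteness is needed. -/
theorem AnalyticAt.natCast_analyticOrderNatAt {f : ℂ → ℂ} {z : ℂ} (hf : AnalyticAt ℂ f z) :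
    ((analyticOrderNatAt f z : ℕ) : ℤ) = (meromorphicOrderAt f z).untop₀ := by
  rw [hf.meromorphicOrderAt_eq, analyticOrderNatAt]
  cases analyticOrderAt f z with
  | top => rfl
  | coe n => rfl

theorem AnalyticAt.analyticOrderAt_ne_top_of_meromorphicOrderAt_ne_top {f : ℂ → ℂ} {z : ℂ}
    (hf : AnalyticAt ℂ f z) (h : meromorphicOrderAt f z ≠ ⊤) : analyticOrderAt f z ≠ ⊤ := fun h' =>
  h (by rw [hf.meromorphicOrderAt_eq, h']; rfl)

theorem sum_analyticOrderNatAt_le {τ : ℂ} (hτ : τ.re = 0) (hτ0 : τ ≠ 0) {N : ℕ} {f : ℂ → ℂ}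
    (hf : f ∈ ellipticSpace τ N) {u₀ : ℂ} (hu₀ : meromorphicOrderAt f u₀ ≠ ⊤) (T : Finset ℝ)
    (hT : ∀ x ∈ T, x ∈ Set.Ico (0 : ℝ) 1) :
    ∑ x ∈ T, analyticOrderNatAt f (τ / 2 + x) ≤ N := by
  classical
  have hinj : Set.InjOn (fun x : ℝ => τ / 2 + (x : ℂ)) T := fun x _ y _ h => by simpa using h
  have := sum_meromorphicOrderAt_le hτ hτ0 hf hu₀ (T.image fun x : ℝ => τ / 2 + (x : ℂ)) ?_ ?_
  · rw [Finset.sum_image hinj] at this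
    rw [Finset.sum_congr rfl fun x _ => ((hf.2.2.2.1 _ (half_add_notMem_torusLattice hτ hτ0
      x)).natCast_analyticOrderNatAt).symm] at this
    exact_mod_cast this
  · intro a ha
    obtain ⟨x, -, rfl⟩ := Finset.mem_image.1 ha
    exact half_add_notMem_torusLattice hτ hτ0 x
  · intro a ha b hb hab
    obtain ⟨x, hx, rfl⟩ := Finset.mem_image.1 ha
    obtain ⟨y, hy, rfl⟩ := Finset.mem_image.1 hb
    rw [eq_of_sub_mem_torusLattice hτ (hT x hx) (hT y hy) hab]

/-- The set of zeros of odd order in `[0, 1)` of a function restricted to the cycle is finite. -/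
theorem exists_finset_odd_order {τ : ℂ} (hτ : τ.re = 0) (hτ0 : τ ≠ 0) {N : ℕ} {f : ℂ → ℂ}
    (hf : f ∈ ellipticSpace τ N) {u₀ : ℂ} (hu₀ : meromorphicOrderAt f u₀ ≠ ⊤) :
    ∃ D : Finset ℝ, ∀ x, x ∈ D ↔ x ∈ Set.Ico (0 : ℝ) 1 ∧ Odd (analyticOrderNatAt f (τ / 2 + x)) := by
  have hfin : {x : ℝ | x ∈ Set.Ico (0 : ℝ) 1 ∧ Odd (analyticOrderNatAt f (τ / 2 + x))}.Finite := by
    by_contra hinf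
    obtain ⟨T, hT, hcard⟩ := Set.Infinite.exists_subset_card_eq hinf (N + 1)
    have h1 := sum_analyticOrderNatAt_le hτ hτ0 hf hu₀ T fun x hx => (hT hx).1
    have h2 := Finset.card_nsmul_le_sum T (fun x : ℝ => analyticOrderNatAt f (τ / 2 + x)) 1
      fun x hx => (hT hx).2.pos
    rw [hcard] at h2
    simp at h2
    omega
  exact ⟨hfin.toFinset, fun x => by simp⟩

theorem integral_mul_pos {u v : ℝ → ℝ} (hu : Continuous u) (hu0 : ∀ x, 0 ≤ u x)
    (hne : ∀ᶠ s in 𝓝[≠] (1 / 2 : ℝ), u s ≠ 0) (hv : ∀ x ∈ Set.Icc (0 : ℝ) 1, 0 < v x)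
    (hvi : IntervalIntegrable v volume 0 1) : 0 < ∫ x in (0 : ℝ)..1, u x * v x := by
  have hmem : ∀ x ∈ Set.Ioc (0 : ℝ) 1, 0 < v x := fun x hx => hv x ⟨hx.1.le, hx.2⟩
  rw [intervalIntegral.integral_pos_iff_support_of_nonneg_ae' ?_ (hvi.continuousOn_mul hu.continuousOn)]
  · refine ⟨one_pos, ?_⟩
    -- An interval to the right of `1 / 2` supplies positive measure to the support; the point is an
    -- arbitrary interior one.
    have hev : ∀ᶠ s in 𝓝[>] (1 / 2 : ℝ), u s ≠ 0 :=
      hne.filter_mono (nhdsWithin_mono _ fun s (hs : 1 / 2 < s) => hs.ne')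
    obtain ⟨b, hb, hbs⟩ := mem_nhdsGT_iff_exists_Ioo_subset.1 hev
    have hb : 1 / 2 < b := hb
    have hsub : Set.Ioo (1 / 2 : ℝ) (min b 1) ⊆
        Function.support (fun x => u x * v x) ∩ Set.Ioc 0 1 := fun s hs => by
      have h1 : s < b := hs.2.trans_le (min_le_left _ _)
      have h2 : s < 1 := hs.2.trans_le (min_le_right _ _)
      have h3 : s ∈ Set.Ioc (0 : ℝ) 1 := ⟨by linarith [hs.1], h2.le⟩
      exact ⟨mul_ne_zero (hbs ⟨hs.1, h1⟩) (hmem s h3).ne', h3⟩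
    refine lt_of_lt_of_le ?_ (measure_mono hsub)
    rw [Real.volume_Ioo, ENNReal.ofReal_pos, sub_pos, lt_min_iff]
    exact ⟨hb, by norm_num⟩
  · rw [Set.uIoc_of_le zero_le_one]
    refine (ae_restrict_iff' measurableSet_Ioc).2 (Eventually.of_forall fun x hx => ?_)
    exact mul_nonneg (hu0 x) (hmem x hx).le

/-- If `f` and `g` are real on the cycle and their product has only zeros of even order there, then
their pairing does not vanish. -/
theorem cyclePairing_ne_zero {τ : ℂ} (hτ : τ.re = 0) (hτ0 : τ ≠ 0) {w : ℂ → ℝ}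
    (hw : IsCycleWeight τ w) {M N : ℕ} {f g : ℂ → ℂ} (hf : f ∈ ellipticSpace τ M)
    (hg : g ∈ ellipticSpace τ N) (hfim : ∀ x : ℝ, (f (τ / 2 + x)).im = 0)
    (hgim : ∀ x : ℝ, (g (τ / 2 + x)).im = 0)
    (heven : ∀ x : ℝ, ∃ m : ℕ, analyticOrderAt (fun z => f z * g z) (τ / 2 + x) = (2 * m : ℕ)) :
    cyclePairing τ w f g ≠ 0 := by
  have hfan : ∀ x : ℝ, AnalyticAt ℂ f (τ / 2 + x) := fun x =>
    hf.2.2.2.1 _ (half_add_notMem_torusLattice hτ hτ0 x)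
  have hgan : ∀ x : ℝ, AnalyticAt ℂ g (τ / 2 + x) := fun x =>
    hg.2.2.2.1 _ (half_add_notMem_torusLattice hτ hτ0 x)
  have him : ∀ x : ℝ, (f (τ / 2 + x) * g (τ / 2 + x)).im = 0 := fun x => by
    simp [hfim x, hgim x]
  set u : ℝ → ℝ := fun x => (f (τ / 2 + x) * g (τ / 2 + x)).re with hu
  have huc : Continuous u := Complex.continuous_re.comp
    ((continuous_comp_half_add hτ hτ0 hf).mul (continuous_comp_half_add hτ hτ0 hg))
  have huv : ∀ x : ℝ, f (τ / 2 + x) * g (τ / 2 + x) = (u x : ℂ) := fun x =>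
    Complex.ext rfl (by simpa using him x)
  have hne : ∀ᶠ s in 𝓝[≠] (1 / 2 : ℝ), u s ≠ 0 := by
    obtain ⟨m, hm⟩ := heven (1 / 2)
    filter_upwards [eventually_apply_add_ofReal_ne_zero (F := fun z => f z * g z)
      ((hfan (1 / 2)).mul (hgan (1 / 2))) (by rw [hm]; exact ENat.natCast_ne_top _)] with s hs h0
    exact hs (by rw [huv, h0, Complex.ofReal_zero])
  have hint : cyclePairing τ w f g = ((∫ x in (0 : ℝ)..1, u x * w (τ / 2 + x) : ℝ) : ℂ) := by
    rw [cyclePairing, ← intervalIntegral.integral_ofReal]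
    simp only [huv, Complex.ofReal_mul]
  rw [hint, Complex.ofReal_ne_zero]
  rcases nonneg_or_nonpos_of_even_order (F := fun z => f z * g z) him
    (fun x => (hfan x).mul (hgan x)) heven with h | h
  · exact (integral_mul_pos huc h hne hw.pos hw.integrable).ne'
  · have := integral_mul_pos (u := fun x => -u x) huc.neg (fun x => neg_nonneg.2 (h x))
      (hne.mono fun s hs => neg_ne_zero.2 hs) hw.pos hw.integrable
    simp only [neg_mul, intervalIntegral.integral_neg] at this
    linarith

end Zeros

/-! ### Lower bound for the number of sign changes. -/

section Family

open ComplexConjugate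

variable {τ : ℂ} {w : ℂ → ℝ} {π : ℕ → ℂ → ℂ}

/-- A nontrivial real combination of functions vanishing at prescribed points, fewer in number than
the functions. -/
theorem exists_real_combination_eq_zero (s : Finset ℕ) (D : Finset ℝ) (h : D.card < s.card)
    (u : ℕ → ℝ → ℝ) :
    ∃ c : ℕ → ℝ, (∃ j ∈ s, c j ≠ 0) ∧ ∀ d ∈ D, ∑ m ∈ s, c m * u m d = 0 := by
  classical
  have hker := LinearMap.ker_ne_bot_of_finrank_lt
    (f := Matrix.mulVecLin (Matrix.of fun (d : D) (m : s) => u m d)) (by simpa using h)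
  obtain ⟨v, hv, hv0⟩ := (Submodule.ne_bot_iff _).1 hker
  obtain ⟨j, hj⟩ := Function.ne_iff.1 hv0
  refine ⟨fun m => if hm : m ∈ s then v ⟨m, hm⟩ else 0, ⟨j, j.2, by simpa using hj⟩, fun d hd => ?_⟩
  have := congrFun (LinearMap.mem_ker.1 hv) ⟨d, hd⟩
  simp only [Matrix.mulVecLin_apply, Matrix.mulVec, dotProduct, Matrix.of_apply, Pi.zero_apply]
    at this
  rw [← this, ← Finset.sum_coe_sort s]
  exact Finset.sum_congr rfl fun m _ => by simp [mul_comm]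

/-- The orthonormal elliptic polynomial of degree `n` changes sign at least `n - 1` times on the
cycle. -/
theorem IsOrthonormalEOPFamily.le_card_odd_order (hτ : τ.re = 0) (hτ0 : τ ≠ 0)
    (hw : IsCycleWeight τ w) (hπ : IsOrthonormalEOPFamily τ w π) {n : ℕ} (hn : n ≠ 1)
    (D : Finset ℝ) (hD : ∀ x, x ∈ D ↔
      x ∈ Set.Ico (0 : ℝ) 1 ∧ Odd (analyticOrderNatAt (π n) (τ / 2 + x))) :
    n < D.card + 2 := by
  classical
  by_contra! hlt
  have hmem : ∀ {m}, m ≠ 1 → π m ∈ ellipticSpace τ m := fun hm => (hπ.elliptic _ hm).mem_ellipticSpace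
  have hγan : ∀ {N : ℕ} {f : ℂ → ℂ}, f ∈ ellipticSpace τ N → ∀ x : ℝ, AnalyticAt ℂ f (τ / 2 + x) :=
    fun hf x => hf.2.2.2.1 _ (half_add_notMem_torusLattice hτ hτ0 x)
  have hntop : ∀ z, meromorphicOrderAt (π n) z ≠ ⊤ :=
    meromorphicOrderAt_ne_top_of_mem_ellipticSpace (hmem hn) (u := 0)
      (by simp [(hπ.elliptic n hn).order_zero])
  have hnfin : ∀ x : ℝ, analyticOrderAt (π n) (τ / 2 + x) ≠ ⊤ := fun x =>
    (hγan (hmem hn) x).analyticOrderAt_ne_top_of_meromorphicOrderAt_ne_top (hntop _)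
  have hDeven : Even D.card := even_card_of_odd_order (hπ.im_apply hτ hτ0 hw hn) (hγan (hmem hn))
    (hπ.elliptic n hn).periodic_one hnfin D hD
  set k := D.card with hk
  set s := (Finset.range (k + 2)).erase 1 with hs
  have hs1 : ∀ m ∈ s, m ≠ 1 := fun m hm => Finset.ne_of_mem_erase hm
  have hsk : ∀ m ∈ s, m ≤ k + 1 := fun m hm => by
    have := Finset.mem_range.1 (Finset.mem_of_mem_erase hm); omega
  have hscard : s.card = k + 1 := by
    rw [hs, Finset.card_erase_of_mem (by simp), Finset.card_range]; rfl
  obtain ⟨c, ⟨j, hjs, hj⟩, hc⟩ := exists_real_combination_eq_zero s D (by omega)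
    fun m x => (π m (τ / 2 + x)).re
  set p : ℂ → ℂ := fun z => ∑ m ∈ s, (c m : ℂ) * π m z with hp
  have hpmem : p ∈ ellipticSpace τ (k + 1) := by
    have : p = ∑ m ∈ s, (c m : ℂ) • π m := by
      funext z; simp [hp]
    rw [this]
    exact Submodule.sum_mem _ fun m hm => Submodule.smul_mem _ _
      (ellipticSpace_mono τ (hsk m hm) (hmem (hs1 m hm)))
  have hpγ : ∀ x : ℝ, p (τ / 2 + x) = ((∑ m ∈ s, c m * (π m (τ / 2 + x)).re : ℝ) : ℂ) := by
    intro x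
    push_cast
    refine Finset.sum_congr rfl fun m hm => ?_
    congr 1
    exact Complex.ext rfl (by simpa using hπ.im_apply hτ hτ0 hw (hs1 m hm) x)
  have hpim : ∀ x : ℝ, (p (τ / 2 + x)).im = 0 := fun x => by rw [hpγ, Complex.ofReal_im]
  -- If `p` vanished identically, pairing it with `π j` would give `c j = 0`.
  have hptop : ∀ z, meromorphicOrderAt p z ≠ ⊤ := by
    intro z hz
    have h1 := hπ.cyclePairing_sum hτ hτ0 hw hs1 (fun m => (c m : ℂ)) (hs1 j hjs)
    have h2 : cyclePairing τ w p (π j) = 0 := by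
      have : ∀ x : ℝ, p (τ / 2 + x) = 0 := fun x =>
        apply_eq_zero_of_meromorphicOrderAt_eq_top hpmem hz (half_add_notMem_torusLattice hτ hτ0 x)
      simp [cyclePairing, this]
    rw [if_pos hjs] at h1
    exact hj (by exact_mod_cast h1.symm.trans h2)
  have hpfin : ∀ x : ℝ, analyticOrderAt p (τ / 2 + x) ≠ ⊤ := fun x =>
    (hγan hpmem x).analyticOrderAt_ne_top_of_meromorphicOrderAt_ne_top (hptop _)
  obtain ⟨E, hE⟩ := exists_finset_odd_order hτ hτ0 hpmem (hptop 0)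
  have hEeven : Even E.card := even_card_of_odd_order hpim (hγan hpmem) hpmem.1 hpfin E hE
  set o : ℝ → ℕ := fun x => analyticOrderNatAt p (τ / 2 + x) with ho
  have hoD : ∀ x ∈ D, 1 ≤ o x := by
    intro x hx
    have h0 : p (τ / 2 + x) = 0 := by rw [hpγ, hc x hx, Complex.ofReal_zero]
    have := (hγan hpmem x).analyticOrderAt_ne_zero.2 h0
    rw [← Nat.cast_analyticOrderNatAt (hpfin x)] at this
    exact Nat.one_le_iff_ne_zero.2 (by exact_mod_cast this)
  have hmemIco : ∀ x ∈ D ∪ E, x ∈ Set.Ico (0 : ℝ) 1 := fun x hx => by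
    rcases Finset.mem_union.1 hx with h | h
    exacts [((hD x).1 h).1, ((hE x).1 h).1]
  -- The valence bound gives only `k + 1`. The sum has the parity of `E.card`, hence is even, and
  -- `k` is even, so one unit is gained.
  have hsum : ∑ x ∈ D ∪ E, o x ≤ k := by
    have h1 : ∑ x ∈ D ∪ E, o x ≤ k + 1 := sum_analyticOrderNatAt_le hτ hτ0 hpmem (hptop 0) _ hmemIco
    have h2 : Even (∑ x ∈ D ∪ E, o x) := by
      rw [← Nat.not_odd_iff_even, Finset.odd_sum_iff_odd_card_odd]
      have : (D ∪ E).filter (fun x => Odd (o x)) = E := by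
        ext x
        rw [Finset.mem_filter]
        constructor
        · rintro ⟨h1, h2⟩
          exact (hE x).2 ⟨hmemIco x h1, h2⟩
        · intro h
          exact ⟨Finset.mem_union_right _ h, ((hE x).1 h).2⟩
      rw [this, Nat.not_odd_iff_even]
      exact hEeven
    obtain ⟨a, ha⟩ := h2
    obtain ⟨b, hb⟩ := hDeven
    omega
  have hone : ∀ x ∈ D ∪ E, 1 ≤ o x := fun x hx => by
    rcases Finset.mem_union.1 hx with h | h
    exacts [hoD x h, ((hE x).1 h).2.pos]
  -- Every point of `D ∪ E` costs at least one, and `D` alone exhausts the bound `k`; this also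
  -- makes the zeros on `D` simple.
  have hDE : D ∪ E = D := by
    refine (Finset.eq_of_subset_of_card_le Finset.subset_union_left ?_).symm
    have : (D ∪ E).card ≤ ∑ x ∈ D ∪ E, o x := by
      simpa using Finset.card_nsmul_le_sum (D ∪ E) o 1 hone
    exact this.trans hsum
  rw [hDE] at hsum
  have ho1 : ∀ x ∈ D, o x = 1 := by
    have : ∑ x ∈ D, 1 = ∑ x ∈ D, o x := by
      refine le_antisymm (Finset.sum_le_sum hoD) ?_
      simpa [← hk] using hsum
    exact fun x hx => ((Finset.sum_eq_sum_iff_of_le hoD).1 this x hx).symm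
  have hED : ∀ x, x ∈ E ↔ x ∈ D := fun x =>
    ⟨fun h => hDE ▸ Finset.mem_union_right D h,
      fun h => (hE x).2 ⟨((hD x).1 h).1, by have := ho1 x h; simp only [ho] at this; rw [this]; exact odd_one⟩⟩
  refine cyclePairing_ne_zero hτ hτ0 hw hpmem (hmem hn) hpim (hπ.im_apply hτ hτ0 hw hn)
    (fun x => ?_) ((hπ.cyclePairing_sum hτ hτ0 hw hs1 (fun m => (c m : ℂ)) hn).trans (if_neg fun h => ?_))
  · have hmul : analyticOrderAt (fun z => p z * π n z) (τ / 2 + x) =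
        analyticOrderAt p (τ / 2 + x) + analyticOrderAt (π n) (τ / 2 + x) :=
      analyticOrderAt_mul (hγan hpmem x) (hγan (hmem hn) x)
    have hfr : Int.fract x ∈ Set.Ico (0 : ℝ) 1 := ⟨Int.fract_nonneg x, Int.fract_lt_one x⟩
    have hpar : Odd (analyticOrderNatAt p (τ / 2 + x)) ↔
        Odd (analyticOrderNatAt (π n) (τ / 2 + x)) := by
      rw [analyticOrderNatAt_add_fract hpmem.1, analyticOrderNatAt_add_fract (hmem hn).1]
      have h1 := hE (Int.fract x)
      have h2 := hD (Int.fract x)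
      have h3 := hED (Int.fract x)
      tauto
    obtain ⟨m, hm⟩ := Nat.even_add'.2 hpar
    refine ⟨m, ?_⟩
    rw [hmul, ← Nat.cast_analyticOrderNatAt (hpfin x), ← Nat.cast_analyticOrderNatAt (hnfin x),
      two_mul, ← hm]
    norm_cast
  · have := hsk n h
    omega

end Family

/-! ### Simplicity of the zeros. -/

theorem corollaryA2 (τ : ℂ) (hτ_re : τ.re = 0) (hτ_ne : τ ≠ 0)
    (w : ℂ → ℝ) (hw : IsCycleWeight τ w)
    (π : ℕ → ℂ → ℂ) (hπ : IsOrthonormalEOPFamily τ w π)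
    (n : ℕ) (hn : n ≠ 1) (z : ℂ) (hz : IsZeroOf (π n) z) :
    IsSimpleZeroOf (π n) z := by
  classical
  have hell := hπ.elliptic n hn
  have hmem := hell.mem_ellipticSpace
  have htop : ∀ z, meromorphicOrderAt (π n) z ≠ ⊤ :=
    meromorphicOrderAt_ne_top_of_mem_ellipticSpace hmem (u := 0) (by simp [hell.order_zero])
  have hzpos : 0 < meromorphicOrderAt (π n) z := hz
  have hzL : z ∉ torusLattice τ := fun h => by
    have h1 := (periodic_of_mem_torusLattice hell.periodic_one hell.periodic_tau
      h).meromorphicOrderAt_add 0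
    rw [zero_add, hell.order_zero] at h1
    rw [h1] at hzpos
    have : 0 < -(n : ℤ) := by exact_mod_cast hzpos
    omega
  obtain ⟨D, hD⟩ := exists_finset_odd_order hτ_re hτ_ne hmem (htop 0)
  have hcard := hπ.le_card_odd_order hτ_re hτ_ne hw hn D hD
  set o : ℂ → ℤ := fun u => (meromorphicOrderAt (π n) u).untop₀ with ho
  have hoz : meromorphicOrderAt (π n) z = (o z : WithTop ℤ) :=
    (WithTop.coe_untop₀_of_ne_top (htop z)).symm
  suffices o z = 1 by
    rw [IsSimpleZeroOf, hoz, this]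
    rfl
  have hzpos : 0 < o z := by
    rw [hoz] at hzpos
    exact_mod_cast hzpos
  by_contra hne
  have hγ : ∀ x : ℝ, ((analyticOrderNatAt (π n) (τ / 2 + x) : ℕ) : ℤ) = o (τ / 2 + x) := fun x =>
    (hell.analyticAt _ (half_add_notMem_torusLattice hτ_re hτ_ne x)).natCast_analyticOrderNatAt
  have hoD : ∀ x ∈ D, 1 ≤ analyticOrderNatAt (π n) (τ / 2 + x) := fun x hx => ((hD x).1 hx).2.pos
  -- If `z` is congruent to a point of `D`, its order is odd and not one, so at least three, and at
  -- least `n - 2` other zeros remain. Otherwise an order of at least two comes on top of at least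
  -- `n - 1` zeros. Both totals exceed `n`.
  by_cases hzD : ∃ d ∈ D, z - (τ / 2 + d) ∈ torusLattice τ
  · obtain ⟨d, hd, hzd⟩ := hzD
    have hper := (periodic_of_mem_torusLattice hell.periodic_one hell.periodic_tau
      hzd).meromorphicOrderAt_add (τ / 2 + d)
    rw [add_sub_cancel] at hper
    have hod : ((analyticOrderNatAt (π n) (τ / 2 + d) : ℕ) : ℤ) = o z := by
      rw [hγ]
      simp only [ho, hper]
    have hodd := ((hD d).1 hd).2
    have h1 := sum_analyticOrderNatAt_le hτ_re hτ_ne hmem (htop 0) D fun x hx => ((hD x).1 hx).1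
    rw [← Finset.add_sum_erase D _ hd] at h1
    have h2 := Finset.card_nsmul_le_sum (D.erase d)
      (fun x : ℝ => analyticOrderNatAt (π n) (τ / 2 + x)) 1
      fun x hx => hoD x (Finset.mem_of_mem_erase hx)
    rw [Finset.card_erase_of_mem hd] at h2
    simp only [smul_eq_mul, mul_one] at h2
    have := Finset.card_pos.2 ⟨d, hd⟩
    obtain ⟨a, ha⟩ := hodd
    omega
  · push Not at hzD
    have hinj : Set.InjOn (fun x : ℝ => τ / 2 + (x : ℂ)) D := fun x _ y _ h => by simpa using h
    have hzim : z ∉ D.image fun x : ℝ => τ / 2 + (x : ℂ) := fun h => by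
      obtain ⟨d, hd, rfl⟩ := Finset.mem_image.1 h
      exact hzD d hd (by simp)
    have h1 := sum_meromorphicOrderAt_le hτ_re hτ_ne hmem (htop 0)
      (insert z (D.image fun x : ℝ => τ / 2 + (x : ℂ))) ?_ ?_
    · rw [Finset.sum_insert hzim, Finset.sum_image hinj] at h1
      have h2 := Finset.card_nsmul_le_sum D (fun x : ℝ => o (τ / 2 + x)) 1 fun x hx => by
        rw [← hγ]
        exact_mod_cast hoD x hx
      simp only [nsmul_eq_mul, mul_one] at h2
      simp only [ho] at h2 hne hzpos
      omega
    · intro a ha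
      rcases Finset.mem_insert.1 ha with rfl | ha
      · exact hzL
      · obtain ⟨x, -, rfl⟩ := Finset.mem_image.1 ha
        exact half_add_notMem_torusLattice hτ_re hτ_ne x
    · intro a ha b hb hab
      rcases Finset.mem_insert.1 ha with rfl | ha' <;> rcases Finset.mem_insert.1 hb with rfl | hb'
      · rfl
      · obtain ⟨x, hx, rfl⟩ := Finset.mem_image.1 hb'
        exact absurd hab (hzD x hx)
      · obtain ⟨x, hx, rfl⟩ := Finset.mem_image.1 ha'
        exact absurd (by simpa using Submodule.neg_mem _ hab) (hzD x hx)
      · obtain ⟨x, hx, rfl⟩ := Finset.mem_image.1 ha'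
        obtain ⟨y, hy, rfl⟩ := Finset.mem_image.1 hb'
        rw [eq_of_sub_mem_torusLattice hτ_re ((hD x).1 hx).1 ((hD y).1 hy).1 hab]
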